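/- **Setting.** Let $1<p<2$, let $E=(\alpha,\beta)\subset\mathbb R$ be an open interval with $-\infty\le\alpha<\beta\le\infty$, let $\tau_o,T>0$ and $E_{-\tau_o,T}=E\times(-\tau_o,T]$. Throughout, "loc" refers to compact subsets of $E$ and compact subintervals of $(-\tau_o,T]$, and $B_r(x)=(x-r,x+r)$. A function $$u\in C_{\rm loc}\big(-\tau_o,T;L^2_{\rm loc}(E)\big)\cap L^p_{\rm loc}\big(-\tau_o,T;W^{1,p}_{\rm loc}(E)\big)$$ is a *local weak super-solution* of $$u_t-(|u_x|^{p-2}u_x)_x=0\quad\text{in }E_{-\tau_o,T}$$ if for every compact set $K\subset E$ and every interval $[t_1,t_2]\subset(-\tau_o,T]$ $$\int_K u\varphi\,dx\Big|_{t_1}^{t_2}+\int_{t_1}^{t_2}\!\!\int_K\big[-u\varphi_t+|u_x|^{p-2}u_x\,\varphi_x\big]\,dx\,dt\ge0$$ for all non-negative $\varphi\in W^{1,2}_{\rm loc}\big(-\tau_o,T;L^2(K)\big)\cap L^p_{\rm loc}\big(-\tau_o,T;W^{1,p}_o(K)\big)$, where $W_o^{1,p}(K)$ is the closure in the $W^{1,p}$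 norm of the smooth functions with compact support in the interior of $K$. For every $t$ the slice $u(\cdot,t)$ is an element of $L^2_{\rm loc}(E)$. Its value at a point $x\in E$ is understood as $$u(x,t)=\liminf_{r\to0^+}\frac1{2r}\int_{x-r}^{x+r}u(z,t)\,dz\in[-\infty,+\infty],$$ which is the value at $x$ of the continuous representative of $u(\cdot,t)$ whenever there is one, hence for almost every $t$. **Proposition 1.1.** For every $p\in(1,2)$ there is a constant $\bar\sigma\in(0,1)$, depending only on $p$, such that the following holds for all $E$, $\tau_o$, $T$ as above. Let $u\ge0$ be a local weak super-solution of the equation in $E_{-\tau_o,T}$, and suppose that for some $y\in E$ and some $M>0$ $$u(y,t)>M\qquad\text{for all }t\in(0,\tfrac T2].$$ Set $\bar\rho=\Big(\dfrac{2^{2-p}T}{M^{2-p}}\Big)^{1/p}$, let $\rho\ge4\bar\rho$, and let $\bar x$ be such that $|\bar x-y|=2\rho$ and $B_\rho(\bar x)\subset B_{4\rho}(y)\subset E$. Then $$u(x,t)\ge\bar\sigma\,M\Big(\frac{\bar\rho}{\rho}\Big)^{\frac p{2-p}}\qquad\text{for all }(x,t)\in B_\rho(\bar x)\times[\tfrac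 T4,\tfrac T2].$$ -/

import Mathlib

open Set Filter Topology MeasureTheory
open scoped ContDiff

/-- The open interval `(α, β)` of the real line, with possibly infinite end points. -/
def openInterval (α β : EReal) : Set ℝ :=
  {x : ℝ | α < (x : EReal) ∧ (x : EReal) < β}

/-- `g` is the weak (distributional) derivative of `f` in the open set `E ⊆ ℝ`. -/
def IsWeakDerivOn (E : Set ℝ) (f g : ℝ → ℝ) : Prop :=
  LocallyIntegrableOn f E ∧ LocallyIntegrableOn g E ∧
    ∀ ψ : ℝ → ℝ, ContDiff ℝ ∞ ψ → HasCompactSupport ψ → tsupport ψ ⊆ E →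
      ∫ x in E, f x * deriv ψ x = -∫ x in E, g x * ψ x

/-- `f ∈ W₀^{1,p}(K)` with derivative `g`: the pair `(f, g)` is a limit in `L^p(K) × L^p(K)` of
pairs `(ψ, ψ')`, where `ψ` is smooth and compactly supported in the interior of `K`. -/
def MemW0 (p : ℝ) (K : Set ℝ) (f g : ℝ → ℝ) : Prop :=
  MemLp f (ENNReal.ofReal p) (volume.restrict K) ∧
  MemLp g (ENNReal.ofReal p) (volume.restrict K) ∧
  ∃ ψ : ℕ → ℝ → ℝ,
    (∀ n, ContDiff ℝ ∞ (ψ n) ∧ HasCompactSupport (ψ n) ∧ tsupport (ψ n) ⊆ interior K) ∧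
    Tendsto (fun n => eLpNorm (fun x => ψ n x - f x) (ENNReal.ofReal p) (volume.restrict K))
      atTop (𝓝 0) ∧
    Tendsto (fun n => eLpNorm (fun x => deriv (ψ n) x - g x) (ENNReal.ofReal p)
      (volume.restrict K)) atTop (𝓝 0)

/-- `u ∈ C_loc(-τ, T; L²_loc(E)) ∩ L^p_loc(-τ, T; W^{1,p}_loc(E))`, with weak derivative `ux` in
space. The time interval is `(-τ, T]`, and "loc" refers to its compact subintervals and to compact
subsets of `E`. Functions are written `u x t` (space first, then time). -/
structure MemSolutionSpace (p : ℝ) (E : Set ℝ) (τ T : ℝ) (u ux : ℝ → ℝ → ℝ) : Prop where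
  memLp_slice : ∀ K ⊆ E, IsCompact K → ∀ t ∈ Ioc (-τ) T,
    MemLp (fun x => u x t) 2 (volume.restrict K)
  continuous_slice : ∀ K ⊆ E, IsCompact K → ∀ t ∈ Ioc (-τ) T,
    Tendsto (fun s => eLpNorm (fun x => u x s - u x t) 2 (volume.restrict K))
      (𝓝[Ioc (-τ) T] t) (𝓝 0)
  memLp : ∀ K ⊆ E, IsCompact K → ∀ t₁ t₂ : ℝ, -τ < t₁ → t₁ ≤ t₂ → t₂ ≤ T →
    MemLp (fun z : ℝ × ℝ => u z.1 z.2) (ENNReal.ofReal p) (volume.restrict (K ×ˢ Icc t₁ t₂))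
  memLp_deriv : ∀ K ⊆ E, IsCompact K → ∀ t₁ t₂ : ℝ, -τ < t₁ → t₁ ≤ t₂ → t₂ ≤ T →
    MemLp (fun z : ℝ × ℝ => ux z.1 z.2) (ENNReal.ofReal p) (volume.restrict (K ×ˢ Icc t₁ t₂))
  weakDeriv : ∀ᵐ t ∂(volume.restrict (Ioc (-τ) T)),
    IsWeakDerivOn E (fun x => u x t) (fun x => ux x t)

/-- `φ ∈ W^{1,2}_loc(-τ, T; L²(K)) ∩ L^p_loc(-τ, T; W₀^{1,p}(K))` and `φ ≥ 0`, with weak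
derivatives `φx` in space and `φt` in time. Membership in `W^{1,2}_loc(-τ, T; L²(K))` is expressed
for the representative that is absolutely continuous in time with values in `L²(K)`: it is
the integral of its derivative `φt ∈ L²_loc(-τ, T; L²(K))`. -/
structure IsTestFunction (p : ℝ) (K : Set ℝ) (τ T : ℝ) (φ φx φt : ℝ → ℝ → ℝ) : Prop where
  nonneg : ∀ t ∈ Ioc (-τ) T, ∀ᵐ x ∂(volume.restrict K), 0 ≤ φ x t
  memLp_slice : ∀ t ∈ Ioc (-τ) T, MemLp (fun x => φ x t) 2 (volume.restrict K)
  memLp_timeDeriv : ∀ t₁ t₂ : ℝ, -τ < t₁ → t₁ ≤ t₂ → t₂ ≤ T →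
    MemLp (fun z : ℝ × ℝ => φt z.1 z.2) 2 (volume.restrict (K ×ˢ Icc t₁ t₂))
  integral_timeDeriv : ∀ t₁ t₂ : ℝ, -τ < t₁ → t₁ ≤ t₂ → t₂ ≤ T →
    ∀ᵐ x ∂(volume.restrict K), φ x t₂ - φ x t₁ = ∫ t in t₁..t₂, φt x t
  memLp : ∀ t₁ t₂ : ℝ, -τ < t₁ → t₁ ≤ t₂ → t₂ ≤ T →
    MemLp (fun z : ℝ × ℝ => φ z.1 z.2) (ENNReal.ofReal p) (volume.restrict (K ×ˢ Icc t₁ t₂))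
  memLp_deriv : ∀ t₁ t₂ : ℝ, -τ < t₁ → t₁ ≤ t₂ → t₂ ≤ T →
    MemLp (fun z : ℝ × ℝ => φx z.1 z.2) (ENNReal.ofReal p) (volume.restrict (K ×ˢ Icc t₁ t₂))
  memW0 : ∀ᵐ t ∂(volume.restrict (Ioc (-τ) T)), MemW0 p K (fun x => φ x t) (fun x => φx x t)

/-- `u` is a local weak super-solution of `u_t - (|u_x|^{p-2} u_x)_x = 0` in `E × (-τ, T]`. -/
def IsLocalWeakSuperSolution (p : ℝ) (E : Set ℝ) (τ T : ℝ) (u : ℝ → ℝ → ℝ) : Prop :=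
  ∃ ux : ℝ → ℝ → ℝ, MemSolutionSpace p E τ T u ux ∧
    ∀ K ⊆ E, IsCompact K → ∀ φ φx φt : ℝ → ℝ → ℝ, IsTestFunction p K τ T φ φx φt →
      ∀ t₁ t₂ : ℝ, -τ < t₁ → t₁ ≤ t₂ → t₂ ≤ T →
        0 ≤ (∫ x in K, u x t₂ * φ x t₂) - (∫ x in K, u x t₁ * φ x t₁)
          + ∫ t in t₁..t₂, ∫ x in K,
              (-(u x t * φt x t) + |ux x t| ^ (p - 2) * ux x t * φx x t)

/-- The value at the point `x` of the time slice `u(·, t)`. A slice is an element of `L²_loc`,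
that is, a class of functions up to null sets; its value at `x` is the lower limit of its mean
values over the intervals `(x - r, x + r)` as `r → 0`. This does not depend on the function that
represents the slice, and it is the value at `x` of the continuous representative whenever there
is one, in particular whenever `u(·, t)` is in `W^{1,p}_loc`, hence for almost every `t`. -/
noncomputable def pointValue (u : ℝ → ℝ → ℝ) (x t : ℝ) : EReal :=
  liminf (fun r : ℝ => ((⨍ z in Ioo (x - r) (x + r), u z t : ℝ) : EReal)) (𝓝[>] (0 : ℝ))

/-- The radius `ρ̄ = (2^{2-p} T / M^{2-p})^{1/p}`. -/
noncomputable def rhoBar (p T M : ℝ) : ℝ :=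
  ((2 : ℝ) ^ (2 - p) * T / M ^ (2 - p)) ^ (1 / p)

/-! In one space dimension the point `y` separates the interval, so a lower bound for `u` at `y`
serves as lateral boundary data, and `u` can be compared with an explicit barrier on the side of `y`
that contains `xbar`.

With m = 1/(2-p), q = p/(2-p), r = `rhoBar p T M` and X the distance to `y` plus r, the barrier is v
= t^m f, where f = B (X^(-q) - S). Because m(p-1) = m - 1, both v_t and (|v_x|^(p-2) v_x)_x carry
the factor t^(m-1), so v is a sub-solution as soon as m f is at most the derivative of the flux of
f. That derivative is a multiple of X^(-q), and a small B depending only on p suffices. At time 0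
the barrier vanishes; at `y` it is at most M/2 by the choice of r; S makes it vanish at distance
7ρ/2, where u ≥ 0 is enough. On the ball around `xbar` and for t ≥ T/4 it is of size T^m ρ^(-q),
which is M (r/ρ)^q up to a constant.

The comparison principle `ae_le_of_isSubsolutionProfile` shows that G(t) = ½∫(v - u)₊² is
nonincreasing. As `u` has no time derivative, the weak inequality on [s, t] is tested with the
excess frozen at the later time t (`energy_slice_le`). This leaves the difference of the fluxes at
times in [s, t] paired with the gradient of the excess at time t. With s = t - h, averaging over t
and using continuity of translations in Lebesgue spaces (`tendsto_integral_translate_mul`), the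
pairing tends to one at equal times, which is nonnegative because the flux is monotone. Hence G
decreases (`le_of_integral_sub_translate_le`), and G(0) = 0.

The frozen excess is admissible for almost every t: by `memW0_max_sub` it is the positive part of an
absolutely continuous function that is nonpositive at both end points. -/

/-! ### Sobolev functions on an interval. -/

/-- A smooth function with compact support in `(a, b)` and zero mean has a smooth primitive with
compact support in `(a, b)`. -/
theorem exists_primitive_hasCompactSupport {a b : ℝ} (hab : a < b) {χ : ℝ → ℝ}
    (hχ : ContDiff ℝ ∞ χ) (hs : HasCompactSupport χ) (hsub : tsupport χ ⊆ Ioo a b)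
    (h0 : ∫ x in a..b, χ x = 0) :
    ContDiff ℝ ∞ (fun x => ∫ s in a..x, χ s) ∧ HasCompactSupport (fun x => ∫ s in a..x, χ s) ∧
      tsupport (fun x => ∫ s in a..x, χ s) ⊆ Ioo a b ∧
      deriv (fun x => ∫ s in a..x, χ s) = χ := by
  obtain ⟨c, d, hac, hdb, hcd⟩ : ∃ c d, a < c ∧ d < b ∧ tsupport χ ⊆ Icc c d := by
    rcases (tsupport χ).eq_empty_or_nonempty with h | h
    · exact ⟨(a + b) / 2, (a + b) / 2, by linarith, by linarith, by simp [h]⟩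
    · obtain ⟨c, hc, hc'⟩ := hs.isCompact.exists_isLeast h
      obtain ⟨d, hd, hd'⟩ := hs.isCompact.exists_isGreatest h
      exact ⟨c, d, (hsub hc).1, (hsub hd).2, fun x hx => ⟨hc' hx, hd' hx⟩⟩
  have hz : ∀ x, x ∉ Icc c d → χ x = 0 := fun x hx =>
    image_eq_zero_of_notMem_tsupport fun h => hx (hcd h)
  have hi : ∀ x y, IntervalIntegrable χ volume x y := fun x y =>
    hχ.continuous.intervalIntegrable x y
  have hd : ∀ x, HasDerivAt (fun x => ∫ s in a..x, χ s) (χ x) x := fun x =>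
    intervalIntegral.integral_hasDerivAt_right (hi _ _)
      (hχ.continuous.stronglyMeasurableAtFilter _ _) hχ.continuous.continuousAt
  have hderiv : deriv (fun x => ∫ s in a..x, χ s) = χ := funext fun x => (hd x).deriv
  have hsupp : ∀ x, x ∉ Icc c d → ∫ s in a..x, χ s = 0 := by
    intro x hx
    rw [mem_Icc, not_and_or, not_le, not_le] at hx
    rcases hx with hx | hx
    · rw [intervalIntegral.integral_congr (g := fun _ => 0)]
      · simp
      · intro y hy
        refine hz y fun h => ?_
        rcases mem_uIcc.1 hy with h' | h' <;> linarith [h.1, h'.2]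
    -- To the right of the support the primitive equals the full integral; this is where zero mean
    -- is needed.
    · rw [← intervalIntegral.integral_add_adjacent_intervals (hi a b) (hi b x), h0, zero_add,
        intervalIntegral.integral_congr (g := fun _ => 0)]
      · simp
      · intro y hy
        refine hz y fun h => ?_
        rcases mem_uIcc.1 hy with h' | h' <;> linarith [h.2, h'.1]
  have hts : tsupport (fun x => ∫ s in a..x, χ s) ⊆ Icc c d :=
    closure_minimal (fun x hx => by_contra fun h => hx (hsupp x h)) isClosed_Icc
  refine ⟨?_, isCompact_Icc.of_isClosed_subset (isClosed_tsupport _) hts,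
    hts.trans fun x hx => ⟨hac.trans_le hx.1, hx.2.trans_lt hdb⟩, hderiv⟩
  rw [contDiff_infty_iff_deriv]
  exact ⟨fun x => (hd x).differentiableAt, by rwa [hderiv]⟩

/-- A smooth function of mean one with compact support in `(a, b)`. -/
theorem exists_contDiff_integral_eq_one {a b : ℝ} (hab : a < b) :
    ∃ η : ℝ → ℝ, ContDiff ℝ ∞ η ∧ HasCompactSupport η ∧ tsupport η ⊆ Ioo a b ∧
      ∫ x in a..b, η x = 1 := by
  let B : ContDiffBump ((a + b) / 2) := ⟨(b - a) / 8, (b - a) / 4, by linarith, by linarith⟩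
  have hsub : tsupport (B.normed volume) ⊆ Ioo a b := by
    rw [B.tsupport_normed_eq, Real.closedBall_eq_Icc]
    intro x hx
    have h1 : (a + b) / 2 - (b - a) / 4 ≤ x := hx.1
    have h2 : x ≤ (a + b) / 2 + (b - a) / 4 := hx.2
    exact ⟨by linarith, by linarith⟩
  refine ⟨B.normed volume, B.contDiff_normed, B.hasCompactSupport_normed, hsub, ?_⟩
  rw [intervalIntegral.integral_of_le hab.le, setIntegral_eq_integral_of_forall_compl_eq_zero,
    B.integral_normed]
  intro x hx
  exact image_eq_zero_of_notMem_tsupport fun h => hx (Ioo_subset_Ioc_self (hsub h))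

/-- Smooth functions with compact support in `(a, b)` are dense in `L^p(a, b)`. -/
theorem exists_contDiff_tsupport_subset_eLpNorm_sub_le {a b : ℝ} (hab : a < b) {p : ENNReal}
    (hp1 : 1 ≤ p) (hp : p ≠ ⊤) {g : ℝ → ℝ} (hg : MemLp g p (volume.restrict (Icc a b))) {ε : ℝ}
    (hε : 0 < ε) :
    ∃ χ : ℝ → ℝ, ContDiff ℝ ∞ χ ∧ HasCompactSupport χ ∧ tsupport χ ⊆ Ioo a b ∧
      eLpNorm (fun x => χ x - g x) p (volume.restrict (Icc a b)) ≤ ENNReal.ofReal ε := by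
  set μ := volume.restrict (Icc a b)
  obtain ⟨δ, hδ, hδ'⟩ := hg.eLpNorm_indicator_le hp1 hp (half_pos hε)
  set r := (b - a) / 2 with hr
  have hr0 : 0 < r := by simp only [hr]; linarith
  set κ := min (δ / 2) (r / 2)
  have hκ : 0 < κ := by positivity
  have hκr : κ ≤ r / 2 := min_le_right _ _
  have hκδ : κ ≤ δ / 2 := min_le_left _ _
  let B : ContDiffBump ((a + b) / 2) := ⟨r - κ, r - κ / 2, by linarith, by linarith⟩
  set S := Metric.closedBall ((a + b) / 2) (r - κ) with hS
  have hSm : MeasurableSet S := Metric.isClosed_closedBall.measurableSet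
  have hsmall : μ Sᶜ ≤ ENNReal.ofReal δ := by
    rw [Measure.restrict_apply hSm.compl]
    have : Sᶜ ∩ Icc a b ⊆ Icc a (a + κ) ∪ Icc (b - κ) b := by
      intro x hx
      by_contra hcon
      refine hx.1 ?_
      rw [hS, Real.closedBall_eq_Icc]
      simp only [mem_union, mem_Icc, not_or, not_and, not_le] at hcon
      have h1 := hcon.1 hx.2.1
      have h2 : x ≤ b - κ := by
        by_contra h
        linarith [hcon.2 (not_le.1 h).le, hx.2.2]
      constructor <;> simp only [hr] <;> linarith
    calc volume (Sᶜ ∩ Icc a b) ≤ volume (Icc a (a + κ)) + volume (Icc (b - κ) b) :=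
          (measure_mono this).trans (measure_union_le _ _)
      _ = ENNReal.ofReal (κ + κ) := by
          rw [Real.volume_Icc, Real.volume_Icc, ← ENNReal.ofReal_add] <;> ring_nf <;> positivity
      _ ≤ ENNReal.ofReal δ := ENNReal.ofReal_le_ofReal (by linarith)
  have h1 := hδ' Sᶜ hSm.compl hsmall
  obtain ⟨h, hh1, hh2, hh3⟩ := (hg.indicator hSm).exist_eLpNorm_sub_le hp hp1 (half_pos hε)
  have htsub : tsupport (fun x => B x * h x) ⊆ tsupport B :=
    tsupport_mul_subset_left
  refine ⟨fun x => B x * h x, B.contDiff.mul hh2, B.hasCompactSupport.mul_right, ?_, ?_⟩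
  · refine htsub.trans ?_
    rw [B.tsupport_eq, Real.closedBall_eq_Icc]
    intro x hx
    have h1 : (a + b) / 2 - (r - κ / 2) ≤ x := hx.1
    have h2 : x ≤ (a + b) / 2 + (r - κ / 2) := hx.2
    constructor <;> simp only [hr] at * <;> linarith
  -- Since B = 1 on S, g - B h = B (1_S g - h) + 1_{Sᶜ} g. The first term is small because B ≤ 1,
  -- the second because Sᶜ has small measure.
  · have hle : eLpNorm (fun x => B x * h x - g x) p μ ≤
        eLpNorm (fun x => B x * (S.indicator g x - h x)) p μ + eLpNorm (Sᶜ.indicator g) p μ := by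
      rw [← eLpNorm_neg]
      refine (le_of_eq ?_).trans (eLpNorm_add_le (f := fun x => B x * (S.indicator g x - h x))
        (g := Sᶜ.indicator g) ?_ ?_ hp1)
      · congr 1
        ext x
        by_cases hx : x ∈ S
        · have : B x = 1 := B.one_of_mem_closedBall hx
          simp [hx, this]
        · simp [hx, sub_eq_neg_add]
      · exact B.continuous.aestronglyMeasurable.mul
          ((hg.indicator hSm).1.sub hh2.continuous.aestronglyMeasurable)
      · exact (hg.indicator hSm.compl).1
    have hle2 : eLpNorm (fun x => B x * (S.indicator g x - h x)) p μ ≤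
        eLpNorm (S.indicator g - h) p μ := by
      refine eLpNorm_mono fun x => ?_
      rw [norm_mul, Pi.sub_apply]
      refine mul_le_of_le_one_left (norm_nonneg _) ?_
      rw [Real.norm_of_nonneg B.nonneg]
      exact B.le_one
    calc _ ≤ _ := hle
      _ ≤ ENNReal.ofReal (ε / 2) + ENNReal.ofReal (ε / 2) := add_le_add (hle2.trans hh3) h1
      _ = ENNReal.ofReal ε := by
          rw [← ENNReal.ofReal_add (by positivity) (by positivity), add_halves]

/-- A primitive of an `L^p` function which vanishes at both end points is in `W₀^{1,p}`. -/
theorem memW0_integral {a b p : ℝ} (hab : a < b) (hp1 : 1 ≤ p) {φ g : ℝ → ℝ}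
    (hg : MemLp g (ENNReal.ofReal p) (volume.restrict (Icc a b)))
    (h0 : ∫ x in a..b, g x = 0)
    (hφ : φ =ᵐ[volume.restrict (Icc a b)] fun x => ∫ s in a..x, g s) :
    MemW0 p (Icc a b) φ g := by
  set μ := volume.restrict (Icc a b) with hμ
  set q := ENNReal.ofReal p with hq
  have hq1 : 1 ≤ q := by rw [hq, ← ENNReal.ofReal_one]; exact ENNReal.ofReal_le_ofReal hp1
  have hqt : q ≠ ⊤ := ENNReal.ofReal_ne_top
  have hgi : IntegrableOn g (Icc a b) := hg.integrable hq1
  have hgi' : ∀ x ∈ Icc a b, IntervalIntegrable g volume a x := fun x hx =>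
    (intervalIntegrable_iff_integrableOn_Icc_of_le hx.1).2
      (hgi.mono_set (Icc_subset_Icc_right hx.2))
  have hcont : ContinuousOn (fun x => ∫ s in a..x, g s) (Icc a b) := by
    rw [← uIcc_of_le hab.le] at hgi ⊢
    exact intervalIntegral.continuousOn_primitive_interval hgi
  have hφL : MemLp φ q μ := by
    refine MemLp.ae_eq hφ.symm ?_
    obtain ⟨C, hC⟩ := isCompact_Icc.exists_bound_of_continuousOn hcont
    refine MemLp.of_bound (hcont.aestronglyMeasurable measurableSet_Icc) C ?_
    filter_upwards [ae_restrict_mem measurableSet_Icc] with x hx using hC x hx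
  refine ⟨hφL, hg, ?_⟩
  obtain ⟨η, hη1, hη2, hη3, hη4⟩ := exists_contDiff_integral_eq_one hab
  -- control of the `L¹` norm by the `L^q` norm
  obtain ⟨C, hCt, hC⟩ : ∃ C : ENNReal, C ≠ ⊤ ∧ ∀ f : ℝ → ℝ, AEStronglyMeasurable f μ →
      eLpNorm f 1 μ ≤ C * eLpNorm f q μ := by
    refine ⟨μ univ ^ (1 / (1 : ENNReal).toReal - 1 / q.toReal), ?_, fun f hf => ?_⟩
    · refine ENNReal.rpow_ne_top_of_nonneg ?_ (by simp [hμ])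
      have : 1 ≤ q.toReal := by
        rw [hq, ENNReal.toReal_ofReal (by linarith)]; exact hp1
      simp only [ENNReal.toReal_one, div_one, sub_nonneg]
      exact inv_eq_one_div q.toReal ▸ inv_le_one_of_one_le₀ this
    · rw [mul_comm]; exact eLpNorm_le_eLpNorm_mul_rpow_measure_univ hq1 hf
  have habs : ∀ f : ℝ → ℝ, AEStronglyMeasurable f μ → ∀ x ∈ Icc a b,
      ENNReal.ofReal |∫ s in a..x, f s| ≤ C * eLpNorm f q μ := by
    intro f hf x hx
    refine le_trans ?_ (hC f hf)
    rw [intervalIntegral.integral_of_le hx.1, ← Real.norm_eq_abs, ofReal_norm,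
      eLpNorm_one_eq_lintegral_enorm]
    refine (enorm_integral_le_lintegral_enorm _).trans (lintegral_mono_set ?_)
    exact fun y hy => ⟨hy.1.le, hy.2.trans hx.2⟩
  have hηq : eLpNorm η q μ ≠ ⊤ :=
    (hη1.continuous.memLp_of_hasCompactSupport hη2 : MemLp η q μ).eLpNorm_ne_top
  have key : ∀ n : ℕ, ∃ χ : ℝ → ℝ, ContDiff ℝ ∞ χ ∧ HasCompactSupport χ ∧ tsupport χ ⊆ Ioo a b ∧
      eLpNorm (fun x => χ x - g x) q μ ≤ ENNReal.ofReal (1 / ((n : ℝ) + 1)) := fun n =>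
    exists_contDiff_tsupport_subset_eLpNorm_sub_le hab hq1 hqt hg (by positivity)
  choose χ hχ1 hχ2 hχ3 hχ4 using key
  set I : ℕ → ℝ := fun n => ∫ x in a..b, χ n x with hI
  -- Only zero-mean functions have compactly supported primitives in (a, b), so the mean of χ n is
  -- removed by a multiple of η. The correction tends to 0 because g itself has zero mean.
  set ζ : ℕ → ℝ → ℝ := fun n x => χ n x - I n * η x with hζ
  have hζ1 : ∀ n, ContDiff ℝ ∞ (ζ n) := fun n => (hχ1 n).sub (contDiff_const.mul hη1)
  have hζ2 : ∀ n, HasCompactSupport (ζ n) := fun n => (hχ2 n).sub hη2.mul_left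
  have hζ3 : ∀ n, tsupport (ζ n) ⊆ Ioo a b := fun n =>
    (tsupport_sub _ _).trans (union_subset (hχ3 n) (tsupport_mul_subset_right.trans hη3))
  have hζ0 : ∀ n, ∫ x in a..b, ζ n x = 0 := by
    intro n
    simp only [hζ]
    rw [intervalIntegral.integral_sub ((hχ1 n).continuous.intervalIntegrable _ _)
      ((hη1.continuous.intervalIntegrable _ _).const_mul _),
      intervalIntegral.integral_const_mul, hη4, mul_one, sub_self]
  have hprim := fun n => exists_primitive_hasCompactSupport hab (hζ1 n) (hζ2 n) (hζ3 n) (hζ0 n)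
  have hχg : ∀ n, AEStronglyMeasurable (fun x => χ n x - g x) μ := fun n =>
    (hχ1 n).continuous.aestronglyMeasurable.sub hg.1
  have hζg : ∀ n, AEStronglyMeasurable (fun x => ζ n x - g x) μ := fun n =>
    (hζ1 n).continuous.aestronglyMeasurable.sub hg.1
  have hIn : ∀ n, ENNReal.ofReal |I n| ≤ C * eLpNorm (fun x => χ n x - g x) q μ := by
    intro n
    refine le_trans (le_of_eq ?_) (habs _ (hχg n) b ⟨hab.le, le_rfl⟩)
    rw [intervalIntegral.integral_sub ((hχ1 n).continuous.intervalIntegrable _ _)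
      (hgi' b ⟨hab.le, le_rfl⟩), h0, sub_zero]
  have hlim0 : Tendsto (fun n => eLpNorm (fun x => χ n x - g x) q μ) atTop (𝓝 0) := by
    refine tendsto_of_tendsto_of_tendsto_of_le_of_le tendsto_const_nhds ?_ (fun _ => zero_le)
      hχ4
    rw [← ENNReal.ofReal_zero]
    exact (ENNReal.continuous_ofReal.tendsto 0).comp tendsto_one_div_add_atTop_nhds_zero_nat
  have hζbd : ∀ n, eLpNorm (fun x => ζ n x - g x) q μ ≤
      eLpNorm (fun x => χ n x - g x) q μ +
        C * eLpNorm (fun x => χ n x - g x) q μ * eLpNorm η q μ := by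
    intro n
    have : (fun x => ζ n x - g x) = (fun x => χ n x - g x) - (I n • η) := by
      ext x; simp [hζ]; ring
    rw [this]
    refine (eLpNorm_sub_le (hχg n) (hη1.continuous.aestronglyMeasurable.const_smul _) hq1).trans ?_
    gcongr
    rw [eLpNorm_const_smul]
    gcongr
    rw [← ofReal_norm, Real.norm_eq_abs]
    exact hIn n
  have hζlim : Tendsto (fun n => eLpNorm (fun x => ζ n x - g x) q μ) atTop (𝓝 0) := by
    refine tendsto_of_tendsto_of_tendsto_of_le_of_le tendsto_const_nhds ?_ (fun _ => zero_le)
      hζbd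
    have h1 := ENNReal.Tendsto.const_mul (a := C) hlim0 (Or.inr hCt)
    have h2 := ENNReal.Tendsto.mul_const (b := eLpNorm η q μ) h1 (Or.inr hηq)
    simpa using hlim0.add h2
  refine ⟨fun n x => ∫ s in a..x, ζ n s, fun n => ⟨(hprim n).1, (hprim n).2.1, ?_⟩, ?_, ?_⟩
  · rw [interior_Icc]; exact (hprim n).2.2.1
  · refine tendsto_of_tendsto_of_tendsto_of_le_of_le tendsto_const_nhds
      (h := fun n => μ univ ^ q.toReal⁻¹ * (C * eLpNorm (fun x => ζ n x - g x) q μ)) ?_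
      (fun _ => zero_le) fun n => ?_
    · have h1 := ENNReal.Tendsto.const_mul (a := C) hζlim (Or.inr hCt)
      have h2 := ENNReal.Tendsto.const_mul (a := μ univ ^ q.toReal⁻¹) h1
        (Or.inr (ENNReal.rpow_ne_top_of_nonneg (by positivity) (by simp [hμ])))
      simpa using h2
    · have hfin : C * eLpNorm (fun x => ζ n x - g x) q μ ≠ ⊤ :=
        ENNReal.mul_ne_top hCt (((hζ1 n).continuous.memLp_of_hasCompactSupport (hζ2 n)).sub
          hg).eLpNorm_ne_top
      have := eLpNorm_le_of_ae_bound (p := q) (μ := μ)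
        (f := fun x => (∫ s in a..x, ζ n s) - φ x)
        (C := (C * eLpNorm (fun x => ζ n x - g x) q μ).toReal) ?_
      · rwa [ENNReal.ofReal_toReal hfin] at this
      · filter_upwards [hφ, ae_restrict_mem measurableSet_Icc] with x hx hxm
        rw [hx, ← intervalIntegral.integral_sub ((hζ1 n).continuous.intervalIntegrable _ _)
          (hgi' x hxm), Real.norm_eq_abs, ← ENNReal.ofReal_le_iff_le_toReal hfin]
        exact habs _ (hζg n) x hxm
  · simp only [(hprim _).2.2.2]
    exact hζlim

/-- A function with a weak derivative in `(a, b)` is, almost everywhere, a primitive of it. -/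
theorem IsWeakDerivOn.exists_ae_eq_integral {a b : ℝ} (hab : a < b) {E : Set ℝ}
    (hE : Icc a b ⊆ E) {f g : ℝ → ℝ} (h : IsWeakDerivOn E f g) :
    ∃ c : ℝ, ∀ᵐ x, x ∈ Ioo a b → f x = c + ∫ s in a..x, g s := by
  obtain ⟨hf, hg, hw⟩ := h
  have hfi : IntegrableOn f (Icc a b) := hf.integrableOn_compact_subset hE isCompact_Icc
  have hgi : IntegrableOn g (Icc a b) := hg.integrableOn_compact_subset hE isCompact_Icc
  have hfI : IntervalIntegrable f volume a b := 
    (intervalIntegrable_iff_integrableOn_Icc_of_le hab.le).2 hfi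
  have hgI : IntervalIntegrable g volume a b := 
    (intervalIntegrable_iff_integrableOn_Icc_of_le hab.le).2 hgi
  set P : ℝ → ℝ := fun x => ∫ s in a..x, g s with hP
  have hPac : AbsolutelyContinuousOnInterval P a b :=
    hgI.absolutelyContinuousOnInterval_intervalIntegral left_mem_uIcc
  have hPI : IntervalIntegrable P volume a b := hPac.continuousOn.intervalIntegrable
  obtain ⟨η, hη1, hη2, hη3, hη4⟩ := exists_contDiff_integral_eq_one hab
  -- integrals over `E` of functions supported in `(a, b)`
  have hset : ∀ F : ℝ → ℝ, (∀ x, x ∉ Ioo a b → F x = 0) → ∫ x in E, F x = ∫ x in a..b, F x := by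
    intro F hF
    rw [setIntegral_eq_integral_of_forall_compl_eq_zero fun x hx =>
        hF x fun h => hx (hE (Ioo_subset_Icc_self h)), intervalIntegral.integral_of_le hab.le,
      setIntegral_eq_integral_of_forall_compl_eq_zero fun x hx =>
        hF x fun h => hx (Ioo_subset_Ioc_self h)]
  have hzero : ∀ χ : ℝ → ℝ, tsupport χ ⊆ Ioo a b → ∀ x, x ∉ Ioo a b → χ x = 0 := fun χ hχ x hx =>
    image_eq_zero_of_notMem_tsupport fun h => hx (hχ h)
  -- zero-mean test functions
  have hmean : ∀ χ : ℝ → ℝ, ContDiff ℝ ∞ χ → HasCompactSupport χ → tsupport χ ⊆ Ioo a b →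
      ∫ x in a..b, χ x = 0 → ∫ x in a..b, (f x - P x) * χ x = 0 := by
    intro χ h1 h2 h3 h4
    obtain ⟨k1, k2, k3, k4⟩ := exists_primitive_hasCompactSupport hab h1 h2 h3 h4
    set ψ : ℝ → ℝ := fun x => ∫ s in a..x, χ s with hψ
    have e1 := hw ψ k1 k2 (k3.trans (Ioo_subset_Icc_self.trans hE))
    rw [k4, hset _ fun x hx => by rw [hzero χ h3 x hx, mul_zero],
      hset _ fun x hx => by rw [hzero ψ k3 x hx, mul_zero]] at e1
    have hψac : AbsolutelyContinuousOnInterval ψ a b :=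
      (k1.of_le (by simp)).contDiffOn.absolutelyContinuousOnInterval
    have e2 := hPac.integral_mul_deriv_eq_deriv_mul hψac
    have e3 : ∫ x in a..b, deriv P x * ψ x = ∫ x in a..b, g x * ψ x := by
      refine intervalIntegral.integral_congr_ae ?_
      filter_upwards [hgI.ae_hasDerivAt_integral] with x hx hxm
      rw [(hx (uIoc_subset_uIcc hxm) a left_mem_uIcc).deriv]
    have e4 : ψ b = 0 := h4
    have e5 : ψ a = 0 := by simp [hψ]
    rw [k4, e3, e4, e5] at e2
    have : ∀ x, (f x - P x) * χ x = f x * χ x - P x * χ x := fun x => by ring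
    simp_rw [this]
    rw [intervalIntegral.integral_sub (hfI.mul_continuousOn h1.continuous.continuousOn)
      (hPI.mul_continuousOn h1.continuous.continuousOn), e1, e2]
    ring
  -- Du Bois-Reymond: f - P annihilates all zero-mean test functions, so it is constant, and pairing
  -- with η, which has mean one, identifies the constant.
  set c := ∫ x in a..b, (f x - P x) * η x with hc
  refine ⟨c, ?_⟩
  have hmain := isOpen_Ioo.ae_eq_zero_of_integral_contDiff_smul_eq_zero (U := Ioo a b)
    (f := fun x => f x - P x - c) (μ := volume) ?_ ?_
  · filter_upwards [hmain] with x hx hxm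
    have := hx hxm
    linarith
  · have hfP : IntegrableOn (fun x => f x - P x - c) (Icc a b) :=
      (hfi.sub (hPI.1.congr_set_ae Ioc_ae_eq_Icc.symm)).sub (integrableOn_const (by simp))
    exact (hfP.mono_set Ioo_subset_Icc_self).locallyIntegrableOn
  · intro χ h1 h2 h3
    have hfPI : IntervalIntegrable (fun x => f x - P x) volume a b := hfI.sub hPI
    have hm := hmean (fun x => χ x - (∫ x in a..b, χ x) * η x) (h1.sub (contDiff_const.mul hη1))
      (h2.sub hη2.mul_left)
      ((tsupport_sub _ _).trans (union_subset h3 (tsupport_mul_subset_right.trans hη3))) ?_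
    · have e : ∫ x, χ x • (f x - P x - c) = ∫ x in a..b, χ x * (f x - P x - c) := by
        rw [intervalIntegral.integral_of_le hab.le, setIntegral_eq_integral_of_forall_compl_eq_zero]
        · rfl
        · intro x hx
          rw [hzero χ h3 x fun h => hx (Ioo_subset_Ioc_self h), zero_mul]
      rw [e]
      have e1 : ∀ x, χ x * (f x - P x - c) = (f x - P x) * χ x - c * χ x := fun x => by ring
      have e2 : ∀ x, (f x - P x) * (χ x - (∫ x in a..b, χ x) * η x) =
          (f x - P x) * χ x - (∫ x in a..b, χ x) * ((f x - P x) * η x) := fun x => by ring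
      simp_rw [e2] at hm
      simp_rw [e1]
      have i1 := hfPI.mul_continuousOn h1.continuous.continuousOn
      have i2 := hfPI.mul_continuousOn hη1.continuous.continuousOn
      rw [intervalIntegral.integral_sub i1 (i2.const_mul _),
        intervalIntegral.integral_const_mul] at hm
      rw [intervalIntegral.integral_sub i1 ((h1.continuous.intervalIntegrable _ _).const_mul _),
        intervalIntegral.integral_const_mul]
      linarith
    · rw [intervalIntegral.integral_sub (h1.continuous.intervalIntegrable _ _)
        ((hη1.continuous.intervalIntegrable _ _).const_mul _),
        intervalIntegral.integral_const_mul, hη4, mul_one, sub_self]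

/-- The positive part of an absolutely continuous function is absolutely continuous. -/
theorem AbsolutelyContinuousOnInterval.max_zero {z : ℝ → ℝ} {a b : ℝ}
    (hz : AbsolutelyContinuousOnInterval z a b) :
    AbsolutelyContinuousOnInterval (fun x => max (z x) 0) a b := by
  rw [absolutelyContinuousOnInterval_iff] at hz ⊢
  intro ε hε
  obtain ⟨δ, hδ, h⟩ := hz ε hε
  refine ⟨δ, hδ, fun E hE hd => lt_of_le_of_lt (Finset.sum_le_sum fun i _ => ?_) (h E hE hd)⟩
  rw [Real.dist_eq, Real.dist_eq]
  exact abs_max_sub_max_le_abs _ _ _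

/-- The derivative of the positive part. -/
theorem AbsolutelyContinuousOnInterval.ae_deriv_max_zero {z : ℝ → ℝ} {a b : ℝ}
    (hz : AbsolutelyContinuousOnInterval z a b) :
    ∀ᵐ x, x ∈ uIcc a b → deriv (fun x => max (z x) 0) x = if 0 < z x then deriv z x else 0 := by
  filter_upwards [hz.ae_differentiableAt] with x hx hxm
  have hd := hx hxm
  split_ifs with h
  · refine Filter.EventuallyEq.deriv_eq ?_
    filter_upwards [hd.continuousAt.eventually (lt_mem_nhds h)] with y hy
    exact max_eq_left (le_of_lt hy)
  -- Where z ≤ 0 the positive part attains its global minimum 0. At a corner `deriv` takes its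
  -- default value 0, so the zeros of z need no separate argument.
  · refine IsLocalMin.deriv_eq_zero (Eventually.of_forall fun y => ?_)
    exact (max_eq_right (not_lt.1 h)).trans_le (le_max_right _ _)

/-! ### Point values of slices, and admissible test functions built from them. -/

/-- An almost everywhere lower bound near a point bounds the point value from below. -/
theorem le_pointValue {u : ℝ → ℝ → ℝ} {a b x t c : ℝ} (hx : x ∈ Ioo a b)
    (hint : IntegrableOn (fun z => u z t) (Ioo a b))
    (hc : ∀ᵐ z ∂(volume.restrict (Ioo a b)), c ≤ u z t) :
    (c : EReal) ≤ pointValue u x t := by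
  refine le_liminf_of_le (by isBoundedDefault) ?_
  have h1 : ∀ᶠ r in 𝓝[>] (0 : ℝ), r < min (x - a) (b - x) :=
    mem_nhdsWithin_of_mem_nhds (Iio_mem_nhds (lt_min (by linarith [hx.1]) (by linarith [hx.2])))
  filter_upwards [h1, self_mem_nhdsWithin] with r hr hr0
  have hr0 : 0 < r := hr0
  have hsub : Ioo (x - r) (x + r) ⊆ Ioo a b :=
    Ioo_subset_Ioo (by linarith [lt_min_iff.1 hr]) (by linarith [lt_min_iff.1 hr])
  rw [EReal.coe_le_coe_iff]
  refine Convex.set_average_mem (convex_Ici c) isClosed_Ici ?_ ?_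
    (ae_restrict_of_ae_restrict_of_subset hsub hc) (hint.mono_set hsub)
  · simp [Real.volume_Ioo]; linarith
  · simp [Real.volume_Ioo]

/-- The point value is at most the value of a continuous representative. -/
theorem pointValue_le {u : ℝ → ℝ → ℝ} {U : ℝ → ℝ} {a b x t : ℝ} (hx : x ∈ Ioo a b)
    (hint : IntegrableOn (fun z => u z t) (Ioo a b)) (hU : ContinuousAt U x)
    (hc : ∀ᵐ z, z ∈ Ioo a b → u z t = U z) :
    pointValue u x t ≤ (U x : EReal) := by
  refine EReal.le_of_forall_lt_iff_le.1 fun c hcU => ?_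
  rw [EReal.coe_lt_coe_iff] at hcU
  obtain ⟨δ, hδ, hδ'⟩ := Metric.eventually_nhds_iff.1 (hU.eventually (gt_mem_nhds hcU))
  refine liminf_le_of_frequently_le' (Eventually.frequently ?_)
  have h1 : ∀ᶠ r in 𝓝[>] (0 : ℝ), r < min δ (min (x - a) (b - x)) :=
    mem_nhdsWithin_of_mem_nhds (Iio_mem_nhds
      (lt_min hδ (lt_min (by linarith [hx.1]) (by linarith [hx.2]))))
  filter_upwards [h1, self_mem_nhdsWithin] with r hr hr0
  have hr0 : 0 < r := hr0
  simp only [lt_min_iff] at hr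
  have hsub : Ioo (x - r) (x + r) ⊆ Ioo a b :=
    Ioo_subset_Ioo (by linarith) (by linarith)
  rw [EReal.coe_le_coe_iff]
  refine Convex.set_average_mem (s := Iic c) (convex_Iic c) isClosed_Iic ?_ ?_ ?_
    (hint.mono_set hsub)
  · simp [Real.volume_Ioo]; linarith
  · simp [Real.volume_Ioo]
  · filter_upwards [ae_restrict_of_ae hc, ae_restrict_mem measurableSet_Ioo] with z hz hzm
    rw [mem_Iic, hz (hsub hzm)]
    refine (hδ' ?_).le
    rw [Real.dist_eq, abs_lt]
    exact ⟨by linarith [hzm.1], by linarith [hzm.2]⟩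

/-- The positive part of the difference of a `C¹` function and a weakly differentiable one is in
`W₀^{1,p}` if the difference is nonpositive at the end points. -/
theorem memW0_max_sub {p a b a' b' : ℝ} (hp : 1 ≤ p) (ha : a' < a) (hab : a < b) (hb : b < b')
    {E : Set ℝ} (hE : Icc a' b' ⊆ E) {u : ℝ → ℝ → ℝ} {t : ℝ} {g w w' : ℝ → ℝ}
    (hu : IsWeakDerivOn E (fun x => u x t) g)
    (hg : MemLp g (ENNReal.ofReal p) (volume.restrict (Icc a b)))
    (hw : ∀ x ∈ Icc a b, HasDerivAt w (w' x) x) (hw' : ContinuousOn w' (Icc a b))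
    (hwa : (w a : EReal) ≤ pointValue u a t) (hwb : (w b : EReal) ≤ pointValue u b t) :
    MemW0 p (Icc a b) (fun x => max (w x - u x t) 0)
      (fun x => if u x t < w x then w' x - g x else 0) := by
  have hab' : a' < b' := ha.trans (hab.trans hb)
  have hfi : IntegrableOn (fun x => u x t) (Icc a' b') :=
    hu.1.integrableOn_compact_subset hE isCompact_Icc
  have hgi : IntegrableOn g (Icc a' b') := hu.2.1.integrableOn_compact_subset hE isCompact_Icc
  have hgI : IntervalIntegrable g volume a' b' :=
    (intervalIntegrable_iff_integrableOn_Icc_of_le hab'.le).2 hgi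
  -- The representation is taken on the larger interval so that a and b are interior points, where
  -- the point value is controlled by the continuous representative.
  obtain ⟨c, hc⟩ := hu.exists_ae_eq_integral hab' hE
  set P : ℝ → ℝ := fun x => ∫ s in a'..x, g s with hP
  have hPac' : AbsolutelyContinuousOnInterval P a' b' :=
    hgI.absolutelyContinuousOnInterval_intervalIntegral left_mem_uIcc
  have hsub : Icc a b ⊆ Icc a' b' := Icc_subset_Icc ha.le hb.le
  have hPac : AbsolutelyContinuousOnInterval P a b := by
    refine hPac'.mono ?_
    rwa [uIcc_of_le hab.le, uIcc_of_le hab'.le]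
  have hPcont : ContinuousOn P (Icc a' b') := by
    rw [← uIcc_of_le hab'.le]; exact hPac'.continuousOn
  have hval : ∀ x ∈ Icc a b, pointValue u x t ≤ ((c + P x : ℝ) : EReal) := by
    intro x hx
    have hx' : x ∈ Ioo a' b' := ⟨ha.trans_le hx.1, hx.2.trans_lt hb⟩
    exact pointValue_le (U := fun x => c + P x) hx' (hfi.mono_set Ioo_subset_Icc_self)
      (continuousAt_const.add (hPcont.continuousAt (Icc_mem_nhds hx'.1 hx'.2))) hc
  have hA : w a ≤ c + P a := EReal.coe_le_coe_iff.1 (hwa.trans (hval a ⟨le_rfl, hab.le⟩))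
  have hB : w b ≤ c + P b := EReal.coe_le_coe_iff.1 (hwb.trans (hval b ⟨hab.le, le_rfl⟩))
  have hwac : AbsolutelyContinuousOnInterval w a b := by
    obtain ⟨C, hC⟩ := isCompact_Icc.exists_bound_of_continuousOn hw'
    have hL : LipschitzOnWith (Real.toNNReal C) w (Icc a b) :=
      (convex_Icc a b).lipschitzOnWith_of_nnnorm_hasDerivWithin_le
        (fun x hx => (hw x hx).hasDerivWithinAt) fun x hx => by
          rw [← NNReal.coe_le_coe, coe_nnnorm]
          exact (hC x hx).trans (Real.le_coe_toNNReal C)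
    rw [← uIcc_of_le hab.le] at hL
    exact hL.absolutelyContinuousOnInterval
  set z : ℝ → ℝ := fun x => w x - P x - c with hz
  have hzac : AbsolutelyContinuousOnInterval z a b := by
    have hcst : AbsolutelyContinuousOnInterval (fun _ : ℝ => c) a b :=
      ((LipschitzWith.const c).lipschitzOnWith (s := uIcc a b)).absolutelyContinuousOnInterval
    exact (hwac.sub hPac).sub hcst
  have hzd : ∀ᵐ x, x ∈ Icc a b → deriv z x = w' x - g x := by
    filter_upwards [hgI.ae_hasDerivAt_integral] with x hx hxm
    have h1 := hx (by rw [uIcc_of_le hab'.le]; exact hsub hxm) a' left_mem_uIcc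
    exact (((hw x hxm).sub h1).sub_const c).deriv
  set m : ℝ → ℝ := fun x => max (z x) 0 with hm
  have hmac : AbsolutelyContinuousOnInterval m a b := hzac.max_zero
  have huz : ∀ᵐ x, x ∈ Icc a b → w x - u x t = z x := by
    filter_upwards [hc] with x hx hxm
    rw [hx ⟨ha.trans_le hxm.1, hxm.2.trans_lt hb⟩]
    simp only [hz, hP]
    ring
  set G : ℝ → ℝ := fun x => if u x t < w x then w' x - g x else 0 with hG
  have hGd : ∀ᵐ x, x ∈ Icc a b → deriv m x = G x := by
    filter_upwards [hzac.ae_deriv_max_zero, hzd, huz] with x h1 h2 h3 hxm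
    rw [h1 (by rwa [uIcc_of_le hab.le]), h2 hxm, ← h3 hxm]
    simp only [hG, sub_pos]
  have hma : m a = 0 := by simp only [hm, hz]; rw [max_eq_right]; linarith
  have hmb : m b = 0 := by simp only [hm, hz]; rw [max_eq_right]; linarith
  have hGint : ∀ x ∈ Icc a b, ∫ s in a..x, G s = m x := by
    intro x hx
    have hac := hmac.mono (c := a) (d := x) (by
      rw [uIcc_of_le hab.le, uIcc_of_le hx.1]; exact Icc_subset_Icc_right hx.2)
    have h1 := hac.integral_deriv_eq_sub
    rw [hma, sub_zero] at h1
    rw [← h1]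
    refine intervalIntegral.integral_congr_ae ?_
    filter_upwards [hGd] with y hy hym
    rw [uIoc_of_le hx.1] at hym
    exact (hy ⟨hym.1.le, hym.2.trans hx.2⟩).symm
  have hwL : MemLp w' (ENNReal.ofReal p) (volume.restrict (Icc a b)) := by
    obtain ⟨C, hC⟩ := isCompact_Icc.exists_bound_of_continuousOn hw'
    refine MemLp.of_bound (hw'.aestronglyMeasurable measurableSet_Icc) C ?_
    filter_upwards [ae_restrict_mem measurableSet_Icc] with x hx using hC x hx
  have hGL : MemLp G (ENNReal.ofReal p) (volume.restrict (Icc a b)) := by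
    refine MemLp.of_le (hwL.sub hg) ?_ (Eventually.of_forall fun x => ?_)
    · have : AEStronglyMeasurable (deriv m) (volume.restrict (Icc a b)) :=
        (measurable_deriv m).aestronglyMeasurable
      refine this.congr ?_
      filter_upwards [ae_restrict_of_ae hGd, ae_restrict_mem measurableSet_Icc] with x h1 h2
      exact h1 h2
    · simp only [hG, Pi.sub_apply]
      split_ifs
      · exact le_rfl
      · simp
  refine memW0_integral hab hp hGL (by rw [hGint b ⟨hab.le, le_rfl⟩, hmb]) ?_
  filter_upwards [ae_restrict_of_ae huz, ae_restrict_mem measurableSet_Icc] with x h1 h2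
  rw [hGint x h2, h1 h2]

/-- Integration by parts against a function in `W₀^{1,p}`. -/
theorem MemW0.integral_mul_eq {p a b : ℝ} (hp : 1 ≤ p) (hab : a < b) {φ g A N : ℝ → ℝ}
    (h : MemW0 p (Icc a b) φ g) (hA : ∀ x ∈ Icc a b, HasDerivAt A (N x) x)
    (hN : ContinuousOn N (Icc a b)) :
    ∫ x in Icc a b, A x * g x = -∫ x in Icc a b, N x * φ x := by
  obtain ⟨hφ, hg, ψ, hψ, h1, h2⟩ := h
  set μ := volume.restrict (Icc a b) with hμ
  set q := ENNReal.ofReal p with hq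
  have hq1 : 1 ≤ q := by rw [hq, ← ENNReal.ofReal_one]; exact ENNReal.ofReal_le_ofReal hp
  have hlim : ∀ (B : ℝ → ℝ), ContinuousOn B (Icc a b) → ∀ (f : ℝ → ℝ) (F : ℕ → ℝ → ℝ),
      MemLp f q μ → (∀ n, Continuous (F n) ∧ HasCompactSupport (F n)) →
      Tendsto (fun n => eLpNorm (fun x => F n x - f x) q μ) atTop (𝓝 0) →
      Tendsto (fun n => ∫ x, B x * F n x ∂μ) atTop (𝓝 (∫ x, B x * f x ∂μ)) := by
    intro B hB f F hf hF hl
    obtain ⟨C, hC⟩ := isCompact_Icc.exists_bound_of_continuousOn hB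
    have hBm : AEStronglyMeasurable B μ := hB.aestronglyMeasurable measurableSet_Icc
    have hFL : ∀ n, MemLp (F n) q μ := fun n =>
      (hF n).1.memLp_of_hasCompactSupport (hF n).2
    have hBb : ∀ᵐ x ∂μ, ‖B x‖ ≤ C := by
      filter_upwards [ae_restrict_mem measurableSet_Icc] with x hx using hC x hx
    have hint : ∀ k : ℝ → ℝ, MemLp k q μ → Integrable (fun x => B x * k x) μ := fun k hk =>
      (hk.integrable hq1).bdd_mul hBm hBb
    refine tendsto_integral_of_L1' _ (hint f hf).1 (Eventually.of_forall fun n => hint _ (hFL n)) ?_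
    have hKt : μ univ ^ (1 / (1 : ENNReal).toReal - 1 / q.toReal) ≠ ⊤ := by
      refine ENNReal.rpow_ne_top_of_nonneg ?_ (by simp [hμ])
      have : 1 ≤ q.toReal := by
        rw [hq, ENNReal.toReal_ofReal (by linarith)]; exact hp
      simp only [ENNReal.toReal_one, div_one, sub_nonneg]
      exact inv_eq_one_div q.toReal ▸ inv_le_one_of_one_le₀ this
    refine tendsto_of_tendsto_of_tendsto_of_le_of_le tendsto_const_nhds
      (h := fun n => ENNReal.ofReal C * (eLpNorm (fun x => F n x - f x) q μ *
        μ univ ^ (1 / (1 : ENNReal).toReal - 1 / q.toReal))) ?_ (fun _ => zero_le) fun n => ?_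
    · have := ENNReal.Tendsto.const_mul (a := ENNReal.ofReal C)
        (ENNReal.Tendsto.mul_const hl (Or.inr hKt)) (Or.inr ENNReal.ofReal_ne_top)
      simpa using this
    · refine le_trans (eLpNorm_le_mul_eLpNorm_of_ae_le_mul (g := fun x => F n x - f x) (c := C) ?_ 1)
        (mul_le_mul_right (eLpNorm_le_eLpNorm_mul_rpow_measure_univ hq1
          ((hFL n).sub hf).1) _)
      filter_upwards [hBb] with x hx
      simp only [Pi.sub_apply]
      rw [← mul_sub, norm_mul]
      gcongr
  have hAc : ContinuousOn A (Icc a b) := fun x hx => (hA x hx).continuousAt.continuousWithinAt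
  have hl1 := hlim A hAc g (fun n => deriv (ψ n)) hg
    (fun n => ⟨(hψ n).1.continuous_deriv (by simp), (hψ n).2.1.deriv⟩) h2
  have hl2 := (hlim N hN φ ψ hφ (fun n => ⟨(hψ n).1.continuous, (hψ n).2.1⟩) h1).neg
  refine tendsto_nhds_unique hl1 (hl2.congr fun n => ?_)
  obtain ⟨k1, -, k3⟩ := hψ n
  rw [interior_Icc] at k3
  have hz : ∀ x, x ∉ Ioo a b → ψ n x = 0 := fun x hx =>
    image_eq_zero_of_notMem_tsupport fun h => hx (k3 h)
  have hibp := intervalIntegral.integral_mul_deriv_eq_deriv_mul (a := a) (b := b) (u := A)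
    (v := ψ n) (u' := N) (v' := deriv (ψ n))
    (fun x hx => hA x (by rwa [uIcc_of_le hab.le] at hx))
    (fun x _ => (k1.differentiable (by simp) x).hasDerivAt)
    ((hN.mono (by rw [uIcc_of_le hab.le])).intervalIntegrable)
    ((k1.continuous_deriv (by simp)).intervalIntegrable _ _)
  rw [hz a (by simp), hz b (by simp), intervalIntegral.integral_of_le hab.le,
    intervalIntegral.integral_of_le hab.le] at hibp
  simp only [hμ, integral_Icc_eq_integral_Ioc]
  rw [hibp]
  ring

/-! ### Time translations and averages. -/

/-- Continuity under time translations of the pairing of two functions in dual Lebesgue spaces. -/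
theorem tendsto_integral_translate_mul {P Q : ENNReal} [P.HolderConjugate Q] (hP : P ≠ ⊤)
    {F g : ℝ × ℝ → ℝ} (hF : MemLp F P) (hg : MemLp g Q) :
    Tendsto (fun θ : ℝ => ∫ z : ℝ × ℝ, F (z.1, z.2 - θ) * g z) (𝓝 0) (𝓝 (∫ z, F z * g z)) := by
  have hP1 : 1 ≤ P := ENNReal.HolderConjugate.one_le P Q
  have : Fact (1 ≤ P) := ⟨hP1⟩
  let S : C(ℝ × (ℝ × ℝ), ℝ × ℝ) := ⟨fun w => (w.2.1, w.2.2 - w.1), by fun_prop⟩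
  let s : ℝ → C(ℝ × ℝ, ℝ × ℝ) := fun θ => S.curry θ
  have hs : Continuous s := S.curry.continuous
  have hmp : ∀ θ, MeasurePreserving (s θ) volume volume := fun θ =>
    (MeasurePreserving.id volume).prod (measurePreserving_sub_right volume θ)
  -- Translations act strongly continuously on L^P for finite P; Hölder then transfers this to the
  -- pairing with g.
  have hcont : Continuous fun θ => Lp.compMeasurePreserving (s θ) (hmp θ) (hF.toLp F) :=
    continuous_const.compMeasurePreservingLp hs hmp hP
  have h0 : Lp.compMeasurePreserving (s 0) (hmp 0) (hF.toLp F) = hF.toLp F := by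
    rw [Lp.toLp_compMeasurePreserving]
    congr 1
    ext z
    simp [s, S]
  have hcomp : ∀ θ, MemLp (fun z : ℝ × ℝ => F (z.1, z.2 - θ)) P := fun θ =>
    hF.comp_measurePreserving (hmp θ)
  have hlim : Tendsto (fun θ => eLpNorm (fun z : ℝ × ℝ => F (z.1, z.2 - θ) - F z) P volume)
      (𝓝 0) (𝓝 0) := by
    have h1 := hcont.tendsto 0
    rw [h0, Lp.tendsto_Lp_iff_tendsto_eLpNorm'] at h1
    refine h1.congr fun θ => eLpNorm_congr_ae ?_
    have e1 : (Lp.compMeasurePreserving (s θ) (hmp θ) (hF.toLp F) : ℝ × ℝ → ℝ) =ᵐ[volume]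
        fun z => F (z.1, z.2 - θ) := by
      rw [Lp.toLp_compMeasurePreserving]
      exact MemLp.coeFn_toLp _
    filter_upwards [e1, hF.coeFn_toLp] with z h2 h3
    rw [Pi.sub_apply, h2, h3]
  refine tendsto_integral_of_L1' _ (hF.integrable_mul hg).1
    (Eventually.of_forall fun θ => (hcomp θ).integrable_mul hg) ?_
  refine tendsto_of_tendsto_of_tendsto_of_le_of_le tendsto_const_nhds
    (h := fun θ => eLpNorm (fun z : ℝ × ℝ => F (z.1, z.2 - θ) - F z) P volume *
      eLpNorm g Q volume) ?_ (fun _ => zero_le) fun θ => ?_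
  · simpa using ENNReal.Tendsto.mul_const hlim (Or.inr hg.eLpNorm_ne_top)
  · refine le_trans (le_of_eq ?_) (eLpNorm_smul_le_mul_eLpNorm (p := P) (q := Q) (r := 1) hg.1
      ((hcomp θ).sub hF).1)
    congr 1
    ext z
    simp [sub_mul]

/-- The triple integrability behind averaging a translated pairing in time. -/
theorem integrable_translate_mul {p q : ℝ} (hpq : p.HolderConjugate q) {F g : ℝ × ℝ → ℝ}
    (hF : MemLp F (ENNReal.ofReal p)) (hg : MemLp g (ENNReal.ofReal q)) (h : ℝ) :
    Integrable (fun w : ℝ × (ℝ × ℝ) => F (w.2.1, w.2.2 - w.1) * g w.2)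
      ((volume.restrict (Ioc 0 h)).prod volume) := by
  set ν : Measure ℝ := volume.restrict (Ioc 0 h)
  have hFi : Integrable (fun z => ‖F z‖ ^ p) := by
    have := hF.integrable_norm_rpow (by simp [hpq.pos]) ENNReal.ofReal_ne_top
    rwa [ENNReal.toReal_ofReal hpq.nonneg] at this
  have hgi : Integrable (fun z => ‖g z‖ ^ q) := by
    have := hg.integrable_norm_rpow (by simp [hpq.symm.pos]) ENNReal.ofReal_ne_top
    rwa [ENNReal.toReal_ofReal hpq.symm.nonneg] at this
  -- The shear (θ, x, t) ↦ (θ, x, t - θ) preserves measure, so Young's inequality dominates the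
  -- product by two integrable functions.
  have hmp : MeasurePreserving (fun w : ℝ × (ℝ × ℝ) => (w.1, (w.2.1, w.2.2 - w.1)))
      (ν.prod volume) (ν.prod volume) := by
    refine (MeasurePreserving.id ν).skew_product (g := fun θ (z : ℝ × ℝ) => (z.1, z.2 - θ))
      (by fun_prop) (Eventually.of_forall fun θ => ?_)
    exact ((MeasurePreserving.id volume).prod (measurePreserving_sub_right volume θ)).map_eq
  have hI1 : Integrable (fun w : ℝ × (ℝ × ℝ) => ‖F (w.2.1, w.2.2 - w.1)‖ ^ p)
      (ν.prod volume) :=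
    hmp.integrable_comp_of_integrable (hFi.comp_snd ν)
  have hI2 : Integrable (fun w : ℝ × (ℝ × ℝ) => ‖g w.2‖ ^ q) (ν.prod volume) := hgi.comp_snd ν
  have hm1 : AEStronglyMeasurable (fun w : ℝ × (ℝ × ℝ) => F (w.2.1, w.2.2 - w.1))
      (ν.prod volume) :=
    (hF.1.comp_snd (μ := ν)).comp_measurePreserving hmp
  have hm2 : AEStronglyMeasurable (fun w : ℝ × (ℝ × ℝ) => g w.2) (ν.prod volume) :=
    hg.1.comp_snd
  refine (hI1.add hI2).mono' (hm1.mul hm2) (Eventually.of_forall fun w => ?_)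
  rw [norm_mul]
  refine (Real.young_inequality_of_nonneg (norm_nonneg _) (norm_nonneg _) hpq).trans ?_
  simp only [Pi.add_apply]
  gcongr
  · exact div_le_self (by positivity) hpq.lt.le
  · exact div_le_self (by positivity) hpq.symm.lt.le

/-- Fubini for the time average of a translated pairing. -/
theorem integral_integral_translate_mul {p q : ℝ} (hpq : p.HolderConjugate q) {F g : ℝ × ℝ → ℝ}
    (hF : MemLp F (ENNReal.ofReal p)) (hg : MemLp g (ENNReal.ofReal q)) (h : ℝ) :
    Integrable (fun t => ∫ θ in Ioc 0 h, ∫ x, F (x, t - θ) * g (x, t)) ∧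
    ∫ t, ∫ θ in Ioc 0 h, ∫ x, F (x, t - θ) * g (x, t) =
      ∫ θ in Ioc 0 h, ∫ z : ℝ × ℝ, F (z.1, z.2 - θ) * g z := by
  set ν : Measure ℝ := volume.restrict (Ioc 0 h)
  have hI := integrable_translate_mul hpq hF hg h
  have hmp : MeasurePreserving (fun w : (ℝ × ℝ) × ℝ => (w.1.1, (w.2, w.1.2)))
      ((ν.prod volume).prod volume) (ν.prod volume) :=
    ((MeasurePreserving.id ν).prod (Measure.measurePreserving_swap (μ := (volume : Measure ℝ))
      (ν := (volume : Measure ℝ)))).comp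
      (measurePreserving_prodAssoc ν (volume : Measure ℝ) (volume : Measure ℝ))
  have hI' : Integrable (fun w : (ℝ × ℝ) × ℝ => F (w.2, w.1.2 - w.1.1) * g (w.2, w.1.2))
      ((ν.prod volume).prod volume) := hmp.integrable_comp_of_integrable hI
  have hJ : Integrable (fun w : ℝ × ℝ => ∫ x, F (x, w.2 - w.1) * g (x, w.2)) (ν.prod volume) :=
    hI'.integral_prod_left
  refine ⟨hJ.integral_prod_right, ?_⟩
  rw [← integral_integral_swap (f := fun θ t => ∫ x, F (x, t - θ) * g (x, t)) hJ]
  refine integral_congr_ae ?_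
  filter_upwards [hI.prod_right_ae] with θ hθ
  exact (integral_prod_symm (fun z : ℝ × ℝ => F (z.1, z.2 - θ) * g z) hθ).symm

/-- A continuous function whose backward difference quotients have nonpositive mean in the limit
is nonincreasing. -/
theorem le_of_integral_sub_translate_le {G : ℝ → ℝ} (hG : Continuous G) {t₁ t₂ : ℝ}
    (h : ∀ ε > 0, ∃ h₀ > 0, ∀ h ∈ Ioo 0 h₀, ∫ t in t₁..t₂, (G t - G (t - h)) ≤ ε * h) :
    G t₂ ≤ G t₁ := by
  refine le_of_forall_pos_le_add fun ε hε => ?_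
  obtain ⟨h₀, hh₀, H⟩ := h (ε / 3) (by positivity)
  obtain ⟨δ₁, hδ₁, H₁⟩ := Metric.continuous_iff.1 hG t₁ (ε / 3) (by positivity)
  obtain ⟨δ₂, hδ₂, H₂⟩ := Metric.continuous_iff.1 hG t₂ (ε / 3) (by positivity)
  set k := min h₀ (min δ₁ δ₂) / 2 with hk
  have hm : 0 < min h₀ (min δ₁ δ₂) := lt_min hh₀ (lt_min hδ₁ hδ₂)
  have hk0 : 0 < k := by positivity
  have hkm : k < min h₀ (min δ₁ δ₂) := by linarith
  simp only [lt_min_iff] at hkm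
  have hi : ∀ x y, IntervalIntegrable G volume x y := fun x y => hG.intervalIntegrable x y
  have h1 := H k ⟨hk0, hkm.1⟩
  -- The integral telescopes to two end layers of width k, on which G is close to its values at t₂
  -- and t₁.
  have e1 : ∫ t in t₁..t₂, (G t - G (t - k)) = (∫ t in t₂ - k..t₂, G t) - ∫ t in t₁ - k..t₁, G t := by
    rw [intervalIntegral.integral_sub (hi _ _)
      ((by fun_prop : Continuous fun t => G (t - k)).intervalIntegrable _ _),
      intervalIntegral.integral_comp_sub_right (fun t => G t) k]
    have a1 := intervalIntegral.integral_add_adjacent_intervals (hi (t₁ - k) t₁) (hi t₁ t₂)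
    have a2 := intervalIntegral.integral_add_adjacent_intervals (hi (t₁ - k) (t₂ - k))
      (hi (t₂ - k) t₂)
    linarith
  have b1 : ∫ t in t₁ - k..t₁, G t ≤ ∫ _ in t₁ - k..t₁, (G t₁ + ε / 3) := by
    refine intervalIntegral.integral_mono_on (by linarith) (hi _ _) (by simp) fun t ht => ?_
    have := H₁ t (by rw [Real.dist_eq, abs_lt]; constructor <;> linarith [ht.1, ht.2])
    rw [Real.dist_eq, abs_lt] at this
    linarith
  have b2 : ∫ _ in t₂ - k..t₂, (G t₂ - ε / 3) ≤ ∫ t in t₂ - k..t₂, G t := by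
    refine intervalIntegral.integral_mono_on (by linarith) (by simp) (hi _ _) fun t ht => ?_
    have := H₂ t (by rw [Real.dist_eq, abs_lt]; constructor <;> linarith [ht.1, ht.2])
    rw [Real.dist_eq, abs_lt] at this
    linarith
  rw [intervalIntegral.integral_const, smul_eq_mul, sub_sub_cancel] at b1 b2
  rw [e1] at h1
  have : k * (G t₂ - ε / 3) - k * (G t₁ + ε / 3) ≤ k * (ε / 3) := by linarith
  have h3 : k * (G t₂ - G t₁ - ε) ≤ k * 0 := by linarith
  linarith [le_of_mul_le_mul_left h3 hk0]

/-! ### Algebra of the flux. -/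

/-- The flux `|v|^{p-2} v` of the `p`-Laplacian. -/
noncomputable def pFlux (p v : ℝ) : ℝ := |v| ^ (p - 2) * v

theorem pFlux_of_nonneg {p v : ℝ} (hp : 1 < p) (hv : 0 ≤ v) : pFlux p v = v ^ (p - 1) := by
  rcases hv.eq_or_lt with rfl | hv
  · simp [pFlux, Real.zero_rpow (by linarith : p - 1 ≠ 0)]
  · rw [pFlux, abs_of_pos hv, ← Real.rpow_add_one hv.ne']
    ring_nf

theorem pFlux_neg (p v : ℝ) : pFlux p (-v) = -pFlux p v := by
  simp [pFlux]

theorem monotone_pFlux {p : ℝ} (hp : 1 < p) : Monotone (pFlux p) := by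
  refine monotone_of_odd_of_monotoneOn_nonneg (pFlux_neg p) fun x hx y hy hxy => ?_
  rw [pFlux_of_nonneg hp hx, pFlux_of_nonneg hp hy]
  exact Real.rpow_le_rpow hx hxy (by linarith)

theorem abs_pFlux {p : ℝ} (hp : 1 < p) (v : ℝ) : |pFlux p v| = |v| ^ (p - 1) := by
  rw [← pFlux_of_nonneg hp (abs_nonneg v), pFlux, pFlux, abs_mul, abs_abs,
    abs_of_nonneg (by positivity)]

theorem measurable_pFlux (p : ℝ) : Measurable (pFlux p) := by
  unfold pFlux
  fun_prop

/-- Homogeneity of degree p - 1 lets the time factor of the barrier pass through the flux: with c =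
t^m and m = 1/(2-p), c^(p-1) = t^(m-1). -/
theorem pFlux_mul {p c v : ℝ} (hc : 0 < c) : pFlux p (c * v) = c ^ (p - 1) * pFlux p v := by
  rw [pFlux, pFlux, abs_mul, abs_of_pos hc, Real.mul_rpow hc.le (abs_nonneg v),
    show p - 1 = p - 2 + 1 by ring, Real.rpow_add_one hc.ne']
  ring

/-- A crude Young inequality, obtained by replacing the smaller of the two moduli by the larger. It
yields integrability of flux times gradient without the conjugate exponent. -/
theorem abs_pFlux_mul_le {p : ℝ} (hp : 1 < p) (v w : ℝ) :
    |pFlux p v * w| ≤ |v| ^ p + |w| ^ p := by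
  have key : ∀ x y : ℝ, 0 ≤ x → 0 ≤ y → x ^ (p - 1) * y ≤ x ^ p + y ^ p := by
    intro x y hx hy
    have hm : ∀ z : ℝ, 0 ≤ z → z ^ (p - 1) * z = z ^ p := fun z hz => by
      rcases hz.eq_or_lt with rfl | hz
      · simp [Real.zero_rpow (by linarith : p ≠ 0)]
      · rw [← Real.rpow_add_one hz.ne', sub_add_cancel]
    rcases le_total x y with h | h
    · have : x ^ (p - 1) * y ≤ y ^ (p - 1) * y := by gcongr
      rw [hm y hy] at this
      linarith [Real.rpow_nonneg hx p]
    · have : x ^ (p - 1) * y ≤ x ^ (p - 1) * x := by gcongr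
      rw [hm x hx] at this
      linarith [Real.rpow_nonneg hy p]
  rw [abs_mul, abs_pFlux hp]
  exact key _ _ (abs_nonneg v) (abs_nonneg w)

/-- The growth |v|^(p-1) together with (p-1) q = p places the flux in the dual space, as the
translation lemmas require. -/
theorem MeasureTheory.MemLp.pFlux_comp {α : Type*} [MeasurableSpace α] {μ : Measure α} {p q : ℝ}
    (hpq : q.HolderConjugate p) {f : α → ℝ} (hf : MemLp f (ENNReal.ofReal p) μ) :
    MemLp (fun x => pFlux p (f x)) (ENNReal.ofReal q) μ := by
  have hp : 1 < p := hpq.symm.lt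
  have hm : AEStronglyMeasurable (fun x => pFlux p (f x)) μ :=
    ((measurable_pFlux p).comp_aemeasurable hf.1.aemeasurable).aestronglyMeasurable
  rw [← integrable_norm_rpow_iff hm (by simp [hpq.pos]) ENNReal.ofReal_ne_top,
    ENNReal.toReal_ofReal hpq.nonneg]
  have := hf.integrable_norm_rpow (by simp [hpq.symm.pos]) ENNReal.ofReal_ne_top
  rw [ENNReal.toReal_ofReal hpq.symm.nonneg] at this
  refine this.congr (Eventually.of_forall fun x => ?_)
  simp only [Real.norm_eq_abs]
  rw [abs_pFlux hp, ← Real.rpow_mul (abs_nonneg _), hpq.symm.sub_one_mul_conj]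

/-! ### Energy of the excess and the comparison principle. -/

/-- The spatial profile `f` of a separable sub-solution `t^{1/(2-p)} f(x)` on `[a, b]`; here `f'` is
its derivative and `N` the derivative of its flux. -/
structure IsSubsolutionProfile (p a b : ℝ) (f f' N : ℝ → ℝ) : Prop where
  hasDerivAt : ∀ x ∈ Icc a b, HasDerivAt f (f' x) x
  continuousOn_deriv : ContinuousOn f' (Icc a b)
  hasDerivAt_flux : ∀ x ∈ Icc a b, HasDerivAt (fun x => pFlux p (f' x)) (N x) x
  continuousOn_deriv_flux : ContinuousOn N (Icc a b)
  le : ∀ x ∈ Icc a b, 1 / (2 - p) * f x ≤ N x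

namespace IsSubsolutionProfile

variable {p a b : ℝ} {f f' N : ℝ → ℝ}

theorem continuousOn (h : IsSubsolutionProfile p a b f f' N) : ContinuousOn f (Icc a b) :=
  fun x hx => (h.hasDerivAt x hx).continuousAt.continuousWithinAt

theorem continuousOn_flux (h : IsSubsolutionProfile p a b f f' N) :
    ContinuousOn (fun x => pFlux p (f' x)) (Icc a b) :=
  fun x hx => (h.hasDerivAt_flux x hx).continuousAt.continuousWithinAt

end IsSubsolutionProfile

theorem ContinuousOn.memLp_restrict_isCompact {α : Type*} [TopologicalSpace α] [MeasurableSpace α]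
    [OpensMeasurableSpace α] [T2Space α]
    {μ : Measure α} [IsFiniteMeasureOnCompacts μ] {f : α → ℝ} {K : Set α} (hK : IsCompact K)
    (hf : ContinuousOn f K) (q : ENNReal) : MemLp f q (μ.restrict K) := by
  obtain ⟨C, hC⟩ := hK.exists_bound_of_continuousOn hf
  have : IsFiniteMeasure (μ.restrict K) := ⟨by simpa using hK.measure_lt_top⟩
  refine MemLp.of_bound (hf.aestronglyMeasurable_of_isCompact hK hK.measurableSet) C ?_
  filter_upwards [ae_restrict_mem hK.measurableSet] with x hx using hC x hx

/-- The excess `(t^{1/(2-p)} f - u)₊` of the barrier over the slice of `u`. -/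
noncomputable def excess (p : ℝ) (f : ℝ → ℝ) (u : ℝ → ℝ → ℝ) (t x : ℝ) : ℝ :=
  max (t ^ (1 / (2 - p)) * f x - u x t) 0

/-- The gradient of the excess. -/
noncomputable def excessDeriv (p : ℝ) (f f' : ℝ → ℝ) (u ux : ℝ → ℝ → ℝ) (t x : ℝ) : ℝ :=
  if u x t < t ^ (1 / (2 - p)) * f x then t ^ (1 / (2 - p)) * f' x - ux x t else 0

theorem memLp_excess {p τ T : ℝ} {E : Set ℝ} {u ux : ℝ → ℝ → ℝ}
    (hS : MemSolutionSpace p E τ T u ux) {a b : ℝ} (hE : Icc a b ⊆ E) {f : ℝ → ℝ}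
    (hf : ContinuousOn f (Icc a b)) {t : ℝ} (ht : t ∈ Ioc (-τ) T) :
    MemLp (excess p f u t) 2 (volume.restrict (Icc a b)) := by
  have h1 : MemLp (fun x => t ^ (1 / (2 - p)) * f x - u x t) 2 (volume.restrict (Icc a b)) :=
    ((hf.memLp_restrict_isCompact isCompact_Icc 2).const_mul _).sub
      (hS.memLp_slice _ hE isCompact_Icc t ht)
  exact h1.pos_part

/-- The energy inequality for the excess between two times, with the time-independent test function
given by the excess at the later time. -/
theorem energy_slice_le {p τ T : ℝ} (hp₁ : 1 < p) (hp₂ : p < 2) (hτ : 0 < τ) {E : Set ℝ}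
    {u ux : ℝ → ℝ → ℝ} (hS : MemSolutionSpace p E τ T u ux)
    (hW : ∀ K ⊆ E, IsCompact K → ∀ φ φx φt : ℝ → ℝ → ℝ, IsTestFunction p K τ T φ φx φt →
      ∀ t₁ t₂ : ℝ, -τ < t₁ → t₁ ≤ t₂ → t₂ ≤ T →
        0 ≤ (∫ x in K, u x t₂ * φ x t₂) - (∫ x in K, u x t₁ * φ x t₁)
          + ∫ t in t₁..t₂, ∫ x in K,
              (-(u x t * φt x t) + |ux x t| ^ (p - 2) * ux x t * φx x t))
    {a b : ℝ} (hab : a < b) (hE : Icc a b ⊆ E) {f f' N : ℝ → ℝ}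
    (hf : IsSubsolutionProfile p a b f f' N) {s t : ℝ} (hs : 0 ≤ s) (hst : s ≤ t) (htT : t ≤ T)
    (hW0 : MemW0 p (Icc a b) (excess p f u t) (excessDeriv p f f' u ux t)) :
    (1 / 2 * ∫ x in Icc a b, excess p f u t x ^ 2) -
        (1 / 2 * ∫ x in Icc a b, excess p f u s x ^ 2) ≤
      -∫ r in s..t, ∫ x in Icc a b,
        (r ^ (1 / (2 - p) - 1) * pFlux p (f' x) - pFlux p (ux x r)) *
          excessDeriv p f f' u ux t x := by
  set K := Icc a b with hK
  have hKc : IsCompact K := isCompact_Icc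
  set m := 1 / (2 - p) with hm
  have hm1 : 1 < m := by rw [hm, lt_div_iff₀] <;> linarith
  set φ := excess p f u t with hφ
  set g := excessDeriv p f f' u ux t with hg
  have hmem : ∀ r, 0 ≤ r → r ≤ t → r ∈ Ioc (-τ) T := fun r h1 h2 => ⟨by linarith, h2.trans htT⟩
  have htm := hmem t (hs.trans hst) le_rfl
  have hsm := hmem s hs hst
  have hφ2 : MemLp φ 2 (volume.restrict K) := memLp_excess hS hE hf.continuousOn htm
  have hψ2 : MemLp (excess p f u s) 2 (volume.restrict K) :=
    memLp_excess hS hE hf.continuousOn hsm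
  have hut := hS.memLp_slice K hE hKc t htm
  have hus := hS.memLp_slice K hE hKc s hsm
  have hf2 : MemLp f 2 (volume.restrict K) := hf.continuousOn.memLp_restrict_isCompact hKc 2
  have hvol : ∀ t₁ t₂ : ℝ, (volume.restrict (K ×ˢ Icc t₁ t₂) : Measure (ℝ × ℝ)) =
      (volume.restrict K).prod (volume.restrict (Icc t₁ t₂)) := fun t₁ t₂ =>
    (Measure.prod_restrict K (Icc t₁ t₂)).symm
  have hlift : ∀ h : ℝ → ℝ, MemLp h (ENNReal.ofReal p) (volume.restrict K) → ∀ t₁ t₂ : ℝ,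
      MemLp (fun z : ℝ × ℝ => h z.1) (ENNReal.ofReal p) (volume.restrict (K ×ˢ Icc t₁ t₂)) := by
    intro h hh t₁ t₂
    rw [hvol]
    exact hh.comp_fst _
  -- The test function is constant in time, so its time derivative is 0 and no regularization of u
  -- in time is needed.
  have htest : IsTestFunction p K τ T (fun x _ => φ x) (fun x _ => g x) (fun _ _ => 0) :=
    { nonneg := fun _ _ => Eventually.of_forall fun x => le_max_right _ _
      memLp_slice := fun _ _ => hφ2
      memLp_timeDeriv := fun _ _ _ _ _ => MemLp.zero'
      integral_timeDeriv := fun _ _ _ _ _ => Eventually.of_forall fun x => by simp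
      memLp := fun t₁ t₂ _ _ _ => hlift φ hW0.1 t₁ t₂
      memLp_deriv := fun t₁ t₂ _ _ _ => hlift g hW0.2.1 t₁ t₂
      memW0 := Eventually.of_forall fun _ => hW0 }
  have hweak := hW K hE hKc _ _ _ htest s t hsm.1 hst htT
  simp only [mul_zero, neg_zero, zero_add] at hweak
  -- integrability of the flux term
  have hpr : ∀ {α : Type} [MeasurableSpace α] {μ : Measure α} {h : α → ℝ},
      MemLp h (ENNReal.ofReal p) μ → Integrable (fun z => |h z| ^ p) μ := by
    intro α _ μ h hh
    have := hh.integrable_norm_rpow (by simp; linarith) ENNReal.ofReal_ne_top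
    rwa [ENNReal.toReal_ofReal (by linarith)] at this
  have hfluxint : Integrable (fun z : ℝ × ℝ => pFlux p (ux z.1 z.2) * g z.1)
      ((volume.restrict K).prod (volume.restrict (Icc s t))) := by
    have h1 := hS.memLp_deriv K hE hKc s t hsm.1 hst htT
    have h2 := hlift g hW0.2.1 s t
    rw [hvol] at h1 h2
    refine ((hpr h1).add (hpr h2)).mono' ?_ (Eventually.of_forall fun z => ?_)
    · exact ((measurable_pFlux p).comp_aemeasurable h1.1.aemeasurable).aestronglyMeasurable.mul h2.1
    · exact abs_pFlux_mul_le hp₁ _ _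
  have hI1 : IntervalIntegrable (fun r => ∫ x in K, pFlux p (ux x r) * g x) volume s t :=
    (intervalIntegrable_iff_integrableOn_Icc_of_le hst).2 hfluxint.integral_prod_right
  have hslice : ∀ᵐ r ∂(volume.restrict (Icc s t)),
      Integrable (fun x => pFlux p (ux x r) * g x) (volume.restrict K) := hfluxint.prod_left_ae
  have hfg : Integrable (fun x => pFlux p (f' x) * g x) (volume.restrict K) := by
    have h1 := hf.continuousOn_deriv.memLp_restrict_isCompact (μ := volume) hKc (ENNReal.ofReal p)
    refine ((hpr h1).add (hpr hW0.2.1)).mono' ?_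
      (Eventually.of_forall fun z => abs_pFlux_mul_le hp₁ _ _)
    exact ((measurable_pFlux p).comp_aemeasurable h1.1.aemeasurable).aestronglyMeasurable.mul
      hW0.2.1.1
  set c := ∫ x in K, pFlux p (f' x) * g x with hc
  have hrpow : IntervalIntegrable (fun r : ℝ => r ^ (m - 1)) volume s t :=
    intervalIntegral.intervalIntegrable_rpow' (by linarith)
  have hsplit : ∫ r in s..t, ∫ x in K, (r ^ (m - 1) * pFlux p (f' x) - pFlux p (ux x r)) * g x =
      (t ^ m - s ^ m) / m * c - ∫ r in s..t, ∫ x in K, pFlux p (ux x r) * g x := by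
    have e1 : ∫ r in s..t, ∫ x in K, (r ^ (m - 1) * pFlux p (f' x) - pFlux p (ux x r)) * g x =
        ∫ r in s..t, (r ^ (m - 1) * c - ∫ x in K, pFlux p (ux x r) * g x) := by
      refine intervalIntegral.integral_congr_ae ?_
      rw [uIoc_of_le hst]
      filter_upwards [(ae_restrict_iff' measurableSet_Icc).1 hslice] with r hr hrm
      rw [hc, ← integral_const_mul, ← integral_sub (hfg.const_mul _)
        (hr (Ioc_subset_Icc_self hrm))]
      refine integral_congr_ae (Eventually.of_forall fun x => ?_)
      ring
    rw [e1, intervalIntegral.integral_sub (hrpow.mul_const c) hI1,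
      intervalIntegral.integral_mul_const, integral_rpow (Or.inl (by linarith)), sub_add_cancel]
  have hibp : c = -∫ x in K, N x * φ x :=
    hW0.integral_mul_eq hp₁.le hab hf.hasDerivAt_flux hf.continuousOn_deriv_flux
  have hpow : s ^ m ≤ t ^ m := Real.rpow_le_rpow hs hst (by linarith)
  -- the barrier is a sub-solution
  have hNφ : Integrable (fun x => N x * φ x) (volume.restrict K) :=
    (hf.continuousOn_deriv_flux.memLp_restrict_isCompact hKc 2).integrable_mul hφ2
  have hfφ : Integrable (fun x => f x * φ x) (volume.restrict K) := hf2.integrable_mul hφ2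
  have huφt : Integrable (fun x => u x t * φ x) (volume.restrict K) := hut.integrable_mul hφ2
  have huφs : Integrable (fun x => u x s * φ x) (volume.restrict K) := hus.integrable_mul hφ2
  have hbar : ∫ x in K, f x * φ x ≤ 1 / m * ∫ x in K, N x * φ x := by
    rw [← integral_const_mul]
    refine integral_mono_ae hfφ (hNφ.const_mul _) ?_
    filter_upwards [ae_restrict_mem measurableSet_Icc] with x hx
    have h1 : f x ≤ 1 / m * N x := by
      have := hf.le x hx
      rw [← hm] at this
      rw [div_mul_eq_mul_div, one_mul, le_div_iff₀ (by linarith)]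
      linarith
    have := mul_le_mul_of_nonneg_right h1 (le_max_right _ _ : 0 ≤ φ x)
    rwa [mul_assoc] at this
  have hd : Integrable (fun x => u x t * φ x - u x s * φ x) (volume.restrict K) := huφt.sub huφs
  -- Convexity of the square: with w the excess, ½w(t)² - ½w(s)² ≤ (w(t) - w(s)) w(t). Moreover
  -- w(t)² = (v - u)(t) w(t), while w(s) ≥ (v - u)(s) and w(t) ≥ 0.
  have hG : (1 / 2 * ∫ x in K, φ x ^ 2) - (1 / 2 * ∫ x in K, excess p f u s x ^ 2) ≤
      (t ^ m - s ^ m) * (∫ x in K, f x * φ x) - ((∫ x in K, u x t * φ x) -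
        ∫ x in K, u x s * φ x) := by
    rw [← integral_const_mul, ← integral_const_mul, ← integral_const_mul,
      ← integral_sub (hφ2.integrable_sq.const_mul _) (hψ2.integrable_sq.const_mul _),
      ← integral_sub huφt huφs, ← integral_sub (hfφ.const_mul _) hd]
    refine integral_mono ((hφ2.integrable_sq.const_mul _).sub (hψ2.integrable_sq.const_mul _))
      ((hfφ.const_mul _).sub hd) fun x => ?_
    simp only
    have h1 : φ x ^ 2 = (t ^ m * f x - u x t) * φ x := by
      simp only [hφ, excess, ← hm]
      rcases le_total (t ^ m * f x - u x t) 0 with h | h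
      · simp [max_eq_right h]
      · rw [max_eq_left h]; ring
    have h2 : (s ^ m * f x - u x s) * φ x ≤ excess p f u s x * φ x :=
      mul_le_mul_of_nonneg_right (le_max_left _ _) (le_max_right _ _)
    nlinarith [sq_nonneg (φ x - excess p f u s x)]
  rw [hsplit, hibp]
  have h3 : (t ^ m - s ^ m) * ∫ x in K, f x * φ x ≤
      (t ^ m - s ^ m) * (1 / m * ∫ x in K, N x * φ x) :=
    mul_le_mul_of_nonneg_left hbar (by linarith)
  have h4 : (t ^ m - s ^ m) / m * -∫ x in K, N x * φ x =
      -((t ^ m - s ^ m) * (1 / m * ∫ x in K, N x * φ x)) := by ring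
  rw [h4]
  have h5 : ∫ r in s..t, ∫ x in K, |ux x r| ^ (p - 2) * ux x r * g x =
      ∫ r in s..t, ∫ x in K, pFlux p (ux x r) * g x := rfl
  rw [h5] at hweak
  linarith

/-- The energy of the excess depends continuously on time. -/
theorem continuousOn_integral_excess_sq {p τ T T₁ : ℝ} (hp₂ : p < 2) (hτ : 0 < τ)
    (hT₁ : T₁ ≤ T) {E : Set ℝ} {u ux : ℝ → ℝ → ℝ} (hS : MemSolutionSpace p E τ T u ux) {a b : ℝ}
    (hE : Icc a b ⊆ E) {f : ℝ → ℝ} (hf : ContinuousOn f (Icc a b)) :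
    ContinuousOn (fun t => 1 / 2 * ∫ x in Icc a b, excess p f u t x ^ 2) (Icc 0 T₁) := by
  refine ContinuousOn.mul continuousOn_const ?_
  rw [continuousOn_iff_continuous_domRestrict]
  set μ := volume.restrict (Icc a b)
  have hmem : ∀ t : Icc (0 : ℝ) T₁, (t : ℝ) ∈ Ioc (-τ) T := fun t =>
    ⟨by linarith [t.2.1], t.2.2.trans hT₁⟩
  have hL : ∀ t : Icc (0 : ℝ) T₁, MemLp (excess p f u t) 2 μ := fun t =>
    memLp_excess hS hE hf (hmem t)
  have hf2 : MemLp f 2 μ := hf.memLp_restrict_isCompact isCompact_Icc 2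
  have hu2 : ∀ t : Icc (0 : ℝ) T₁, MemLp (fun x => u x t) 2 μ := fun t =>
    hS.memLp_slice _ hE isCompact_Icc t (hmem t)
  have hc : Continuous fun t : Icc (0 : ℝ) T₁ => (hL t).toLp (excess p f u t) := by
    rw [continuous_iff_continuousAt]
    intro t
    refine (Lp.tendsto_Lp_iff_tendsto_eLpNorm'' _ hL _ (hL t)).2 ?_
    have hpow : Tendsto (fun s : Icc (0 : ℝ) T₁ =>
        ‖(s : ℝ) ^ (1 / (2 - p)) - (t : ℝ) ^ (1 / (2 - p))‖ₑ) (𝓝 t) (𝓝 0) := by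
      have h1 : Continuous fun s : Icc (0 : ℝ) T₁ =>
          ‖(s : ℝ) ^ (1 / (2 - p)) - (t : ℝ) ^ (1 / (2 - p))‖ₑ :=
        (((Real.continuous_rpow_const (by
          rw [one_div, inv_nonneg]; linarith)).comp continuous_subtype_val).sub
          continuous_const).enorm
      simpa using h1.tendsto t
    have hsl : Tendsto (fun s : Icc (0 : ℝ) T₁ => eLpNorm (fun x => u x s - u x t) 2 μ)
        (𝓝 t) (𝓝 0) := by
      refine (hS.continuous_slice _ hE isCompact_Icc t (hmem t)).comp ?_
      exact tendsto_nhdsWithin_iff.2 ⟨continuous_subtype_val.tendsto t,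
        Eventually.of_forall hmem⟩
    refine tendsto_of_tendsto_of_tendsto_of_le_of_le tendsto_const_nhds
      (h := fun s : Icc (0 : ℝ) T₁ =>
        ‖(s : ℝ) ^ (1 / (2 - p)) - (t : ℝ) ^ (1 / (2 - p))‖ₑ * eLpNorm f 2 μ +
          eLpNorm (fun x => u x s - u x t) 2 μ) ?_ (fun _ => zero_le) fun s => ?_
    · simpa using (ENNReal.Tendsto.mul_const hpow (Or.inr hf2.eLpNorm_ne_top)).add hsl
    · simp only
      rw [← eLpNorm_const_smul]
      refine le_trans ?_ (eLpNorm_sub_le (hf2.const_smul _).1 ((hu2 s).sub (hu2 t)).1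
        (by norm_num))
      refine eLpNorm_mono fun x => ?_
      simp only [Pi.sub_apply, excess, Pi.smul_apply, smul_eq_mul, Real.norm_eq_abs]
      refine (abs_max_sub_max_le_abs _ _ _).trans (le_of_eq ?_)
      congr 1
      ring
  have heq : ∀ t : Icc (0 : ℝ) T₁, ∫ x, excess p f u t x ^ 2 ∂μ =
      ‖(hL t).toLp (excess p f u t)‖ ^ 2 := by
    intro t
    rw [← real_inner_self_eq_norm_sq, L2.inner_def]
    refine integral_congr_ae ?_
    filter_upwards [(hL t).coeFn_toLp] with x hx
    rw [hx]
    simp [sq]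
  refine (hc.norm.pow 2).congr fun t => ?_
  exact (heq t).symm

/-- The gradient of the excess is `p`-integrable in space and time. -/
theorem memLp_excessDeriv {p τ T : ℝ} (hp₂ : p < 2) (hτ : 0 < τ) {E : Set ℝ} {u ux : ℝ → ℝ → ℝ}
    (hS : MemSolutionSpace p E τ T u ux) {a b : ℝ} (hE : Icc a b ⊆ E) {f f' : ℝ → ℝ}
    (hf : ContinuousOn f (Icc a b)) (hf' : ContinuousOn f' (Icc a b)) {T₁ : ℝ} (h0 : 0 ≤ T₁)
    (hT₁ : T₁ ≤ T) :
    MemLp (fun z : ℝ × ℝ => excessDeriv p f f' u ux z.2 z.1) (ENNReal.ofReal p)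
      (volume.restrict (Icc a b ×ˢ Icc 0 T₁)) := by
  have hm : 0 ≤ 1 / (2 - p) := by rw [one_div, inv_nonneg]; linarith
  have hprod : ∀ h : ℝ → ℝ, ContinuousOn h (Icc a b) →
      ContinuousOn (fun z : ℝ × ℝ => z.2 ^ (1 / (2 - p)) * h z.1) (Icc a b ×ˢ Icc 0 T₁) :=
    fun h hh => ContinuousOn.mul
      ((Real.continuous_rpow_const hm).comp continuous_snd).continuousOn
      (hh.comp continuousOn_fst fun z hz => hz.1)
  have hKc : IsCompact (Icc a b ×ˢ Icc 0 T₁) := isCompact_Icc.prod isCompact_Icc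
  have h1 := (hprod f hf).memLp_restrict_isCompact (μ := volume) hKc (ENNReal.ofReal p)
  have h2 := (hprod f' hf').memLp_restrict_isCompact (μ := volume) hKc (ENNReal.ofReal p)
  have hu := hS.memLp _ hE isCompact_Icc 0 T₁ (by linarith) h0 hT₁
  have hux := hS.memLp_deriv _ hE isCompact_Icc 0 T₁ (by linarith) h0 hT₁
  have h3 := h2.sub hux
  refine MemLp.of_le h3 ?_ (Eventually.of_forall fun z => ?_)
  · exact (h3.1.indicator₀ (nullMeasurableSet_lt hu.1.aemeasurable h1.1.aemeasurable))
  · simp only [excessDeriv, Pi.sub_apply]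
    split_ifs
    · exact le_rfl
    · simp

/-- The difference of the fluxes of the barrier and of the solution is in the dual Lebesgue
space. -/
theorem memLp_flux_sub {p q τ T : ℝ} (hpq : q.HolderConjugate p) (hp₂ : p < 2) (hτ : 0 < τ)
    {E : Set ℝ} {u ux : ℝ → ℝ → ℝ}
    (hS : MemSolutionSpace p E τ T u ux) {a b : ℝ} (hE : Icc a b ⊆ E) {A : ℝ → ℝ}
    (hA : ContinuousOn A (Icc a b)) {T₁ : ℝ} (h0 : 0 ≤ T₁) (hT₁ : T₁ ≤ T) :
    MemLp (fun z : ℝ × ℝ => z.2 ^ (1 / (2 - p) - 1) * A z.1 - pFlux p (ux z.1 z.2))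
      (ENNReal.ofReal q) (volume.restrict (Icc a b ×ˢ Icc 0 T₁)) := by
  have hm : 0 ≤ 1 / (2 - p) - 1 := by
    rw [sub_nonneg, le_div_iff₀] <;> linarith [hpq.symm.lt]
  have hux := hS.memLp_deriv _ hE isCompact_Icc 0 T₁ (by linarith) h0 hT₁
  refine MemLp.sub ?_ (hux.pFlux_comp hpq)
  refine ContinuousOn.memLp_restrict_isCompact (isCompact_Icc.prod isCompact_Icc) ?_ _
  exact ContinuousOn.mul ((Real.continuous_rpow_const hm).comp continuous_snd).continuousOn
    (hA.comp continuousOn_fst fun z hz => hz.1)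

/-- Comparison of a super-solution with a separable sub-solution. -/
theorem ae_le_of_isSubsolutionProfile {p τ T : ℝ} (hp₁ : 1 < p) (hp₂ : p < 2) (hτ : 0 < τ)
    {E : Set ℝ} {u : ℝ → ℝ → ℝ} (hu : IsLocalWeakSuperSolution p E τ T u) {a b a' b' T₁ : ℝ}
    (ha : a' < a) (hab : a < b) (hb : b < b') (hE : Icc a' b' ⊆ E) (hT₁ : T₁ ≤ T)
    {f f' N : ℝ → ℝ} (hf : IsSubsolutionProfile p a b f f' N)
    (hua : ∀ t ∈ Ioc 0 T₁, ((t ^ (1 / (2 - p)) * f a : ℝ) : EReal) ≤ pointValue u a t)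
    (hub : ∀ t ∈ Ioc 0 T₁, ((t ^ (1 / (2 - p)) * f b : ℝ) : EReal) ≤ pointValue u b t)
    (hu0 : ∀ᵐ x ∂(volume.restrict (Icc a b)), 0 ≤ u x 0) {t : ℝ} (ht : t ∈ Icc 0 T₁) :
    ∀ᵐ x ∂(volume.restrict (Icc a b)), t ^ (1 / (2 - p)) * f x ≤ u x t := by
  obtain ⟨ux, hS, hW⟩ := hu
  have hEK : Icc a b ⊆ E := (Icc_subset_Icc ha.le hb.le).trans hE
  set m := 1 / (2 - p) with hm
  have hm1 : 1 < m := by rw [hm, lt_div_iff₀] <;> linarith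
  set G : ℝ → ℝ := fun t => 1 / 2 * ∫ x in Icc a b, excess p f u t x ^ 2 with hG
  have hT₁0 : 0 ≤ T₁ := ht.1.trans ht.2
  have hGc : ContinuousOn G (Icc 0 T₁) :=
    continuousOn_integral_excess_sq hp₂ hτ hT₁ hS hEK hf.continuousOn
  -- almost every slice of the excess is an admissible test function
  have hW0 : ∀ᵐ t, t ∈ Ioc 0 T₁ →
      MemW0 p (Icc a b) (excess p f u t) (excessDeriv p f f' u ux t) := by
    have h1 := hS.memLp_deriv _ hEK isCompact_Icc 0 T₁ (by linarith) hT₁0 hT₁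
    have h2 : ∀ᵐ t ∂(volume.restrict (Icc 0 T₁)),
        MemLp (fun x => ux x t) (ENNReal.ofReal p) (volume.restrict (Icc a b)) := by
      have h3 := h1.integrable_norm_rpow (by simp; linarith) ENNReal.ofReal_ne_top
      have h4 := h1.1
      rw [Measure.volume_eq_prod, ← Measure.prod_restrict] at h3 h4
      filter_upwards [h3.prod_left_ae, h4.prodMk_right] with t h5 h6
      exact (integrable_norm_rpow_iff h6 (by simp; linarith) ENNReal.ofReal_ne_top).1 h5
    filter_upwards [(ae_restrict_iff' measurableSet_Icc).1 h2,
      (ae_restrict_iff' measurableSet_Ioc).1 hS.weakDeriv] with t h5 h6 htm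
    have h7 := h5 (Ioc_subset_Icc_self htm)
    have h8 := h6 ⟨by linarith [htm.1], htm.2.trans hT₁⟩
    exact memW0_max_sub (w := fun x => t ^ m * f x) (w' := fun x => t ^ m * f' x) hp₁.le ha hab hb
      hE h8 h7 (fun x hx => (hf.hasDerivAt x hx).const_mul _)
      (continuousOn_const.mul hf.continuousOn_deriv) (hua t htm) (hub t htm)
  -- the energy is nonincreasing
  have hmono : ∀ t₁ t₂ : ℝ, 0 < t₁ → t₁ < t₂ → t₂ ≤ T₁ → G t₂ ≤ G t₁ := by
    intro t₁ t₂ h1 h12 h2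
    -- A continuous extension to the whole line, constant outside [0, T₁].
    set G' : ℝ → ℝ := fun t => G (max 0 (min t T₁)) with hG'
    have hG'c : Continuous G' := by
      refine hGc.comp_continuous (by fun_prop) fun t => ⟨le_max_left _ _, ?_⟩
      exact max_le hT₁0 (min_le_right _ _)
    have hGG' : ∀ t ∈ Icc 0 T₁, G' t = G t := fun t ht => by
      simp only [hG', min_eq_left ht.2, max_eq_right ht.1]
    rw [← hGG' t₁ ⟨h1.le, (h12.trans_le h2).le⟩, ← hGG' t₂ ⟨(h1.trans h12).le, h2⟩]
    refine le_of_integral_sub_translate_le hG'c fun ε hε => ?_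
    obtain ⟨q, hpq'⟩ : ∃ q, p.HolderConjugate q := ⟨_, Real.HolderConjugate.conjExponent hp₁⟩
    have hqp : q.HolderConjugate p := hpq'.symm
    have hms : ∀ s t : ℝ, MeasurableSet (Icc a b ×ˢ Ioc s t) := fun s t =>
      measurableSet_Icc.prod measurableSet_Ioc
    set F : ℝ × ℝ → ℝ := (Icc a b ×ˢ Ioc 0 T₁).indicator fun z =>
      z.2 ^ (m - 1) * pFlux p (f' z.1) - pFlux p (ux z.1 z.2) with hF
    set g : ℝ × ℝ → ℝ := (Icc a b ×ˢ Ioc t₁ t₂).indicator fun z =>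
      excessDeriv p f f' u ux z.2 z.1 with hg
    have hFL : MemLp F (ENNReal.ofReal q) := by
      rw [hF, memLp_indicator_iff_restrict (hms _ _)]
      exact (memLp_flux_sub hqp hp₂ hτ hS hEK hf.continuousOn_flux hT₁0 hT₁).mono_measure
        (Measure.restrict_mono (Set.prod_mono le_rfl Ioc_subset_Icc_self) le_rfl)
    have hgL : MemLp g (ENNReal.ofReal p) := by
      rw [hg, memLp_indicator_iff_restrict (hms _ _)]
      refine (memLp_excessDeriv hp₂ hτ hS hEK hf.continuousOn hf.continuousOn_deriv hT₁0
        hT₁).mono_measure (Measure.restrict_mono (Set.prod_mono (le_refl (Icc a b)) ?_) le_rfl)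
      exact fun t ht => ⟨h1.le.trans ht.1.le, ht.2.trans h2⟩
    have hconj : (ENNReal.ofReal q).HolderConjugate (ENNReal.ofReal p) := hqp.ennrealOfReal
    have hlim := tendsto_integral_translate_mul ENNReal.ofReal_ne_top hFL hgL
    -- At equal times, where the excess is positive, both factors are differences between barrier
    -- and solution, one of fluxes and one of gradients; monotonicity of the flux gives them the
    -- same sign.
    have hpos : 0 ≤ ∫ z, F z * g z := by
      refine integral_nonneg fun z => ?_
      simp only [hF, hg, indicator, Pi.zero_apply]
      split_ifs with k1 k2
      · simp only [excessDeriv, ← hm]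
        split_ifs with k3
        · have hz0 : 0 < z.2 := k1.2.1
          have e1 : z.2 ^ (m - 1) * pFlux p (f' z.1) = pFlux p (z.2 ^ m * f' z.1) := by
            rw [pFlux_mul (Real.rpow_pos_of_pos hz0 m), ← Real.rpow_mul hz0.le]
            congr 2
            rw [hm]
            field_simp [(by linarith : (2 : ℝ) - p ≠ 0)]
            ring
          rw [e1]
          rcases le_total (ux z.1 z.2) (z.2 ^ m * f' z.1) with h | h
          · exact mul_nonneg (sub_nonneg.2 (monotone_pFlux hp₁ h)) (sub_nonneg.2 h)
          · exact mul_nonneg_of_nonpos_of_nonpos (sub_nonpos.2 (monotone_pFlux hp₁ h))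
              (sub_nonpos.2 h)
        · simp
      all_goals simp
    obtain ⟨δ, hδ, hδ'⟩ := Metric.eventually_nhds_iff.1
      (hlim.eventually (lt_mem_nhds (show -ε < ∫ z, F z * g z by linarith)))
    -- The bound h < t₁ keeps every shifted time t - θ in (0, T₁], so the cutoff in F is invisible
    -- there.
    refine ⟨min δ t₁, lt_min hδ h1, fun h hh => ?_⟩
    have hh0 := hh.1
    have hhδ : h < δ := hh.2.trans_le (min_le_left _ _)
    have hht : h < t₁ := hh.2.trans_le (min_le_right _ _)
    obtain ⟨hint, hfub⟩ := integral_integral_translate_mul hqp hFL hgL h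
    set J : ℝ → ℝ := fun t => ∫ θ in Ioc 0 h, ∫ x, F (x, t - θ) * g (x, t) with hJ
    have hJ0 : ∀ t, t ∉ Ioc t₁ t₂ → J t = 0 := by
      intro t ht
      have : ∀ x, g (x, t) = 0 := fun x => indicator_of_notMem (fun hx => ht hx.2) _
      simp [hJ, this]
    have hstep : ∀ᵐ t, t ∈ Ioc t₁ t₂ → G' t - G' (t - h) ≤ -J t := by
      filter_upwards [hW0] with t hWt htm
      have htm' : t ∈ Ioc 0 T₁ := ⟨h1.trans htm.1, htm.2.trans h2⟩
      rw [hGG' t (Ioc_subset_Icc_self htm'),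
        hGG' (t - h) ⟨by linarith [htm.1], by linarith [htm'.2]⟩]
      refine (energy_slice_le hp₁ hp₂ hτ hS hW hab hEK hf (s := t - h) (t := t)
        (by linarith [htm.1]) (by linarith) (htm'.2.trans hT₁) (hWt htm')).trans (le_of_eq ?_)
      congr 1
      have e1 := intervalIntegral.integral_comp_sub_left (a := 0) (b := h) (fun r =>
        ∫ x in Icc a b, (r ^ (m - 1) * pFlux p (f' x) - pFlux p (ux x r)) *
          excessDeriv p f f' u ux t x) t
      rw [sub_zero] at e1
      rw [← hm, ← e1, intervalIntegral.integral_of_le hh0.le]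
      refine setIntegral_congr_fun measurableSet_Ioc fun θ hθ => ?_
      rw [← integral_indicator measurableSet_Icc]
      refine integral_congr_ae (Eventually.of_forall fun x => ?_)
      have hθm : t - θ ∈ Ioc 0 T₁ := ⟨by linarith [hθ.2, htm.1], by linarith [hθ.1, htm'.2]⟩
      by_cases hx : x ∈ Icc a b
      · have k1 : (x, t - θ) ∈ Icc a b ×ˢ Ioc 0 T₁ := ⟨hx, hθm⟩
        have k2 : (x, t) ∈ Icc a b ×ˢ Ioc t₁ t₂ := ⟨hx, htm⟩
        simp only [hF, hg, indicator_of_mem hx, indicator_of_mem k1, indicator_of_mem k2]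
      · have k2 : (x, t) ∉ Icc a b ×ˢ Ioc t₁ t₂ := fun k => hx k.1
        simp only [hg, indicator_of_notMem hx, indicator_of_notMem k2, mul_zero]
    have hJint : ∫ t in t₁..t₂, J t = ∫ t, J t := by
      rw [intervalIntegral.integral_of_le h12.le,
        setIntegral_eq_integral_of_forall_compl_eq_zero fun t ht => hJ0 t ht]
    have hGint : IntervalIntegrable (fun t => G' t - G' (t - h)) volume t₁ t₂ :=
      (by fun_prop : Continuous fun t => G' t - G' (t - h)).intervalIntegrable _ _
    calc ∫ t in t₁..t₂, (G' t - G' (t - h)) ≤ ∫ t in t₁..t₂, -J t := by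
          rw [intervalIntegral.integral_of_le h12.le, intervalIntegral.integral_of_le h12.le]
          refine integral_mono_ae hGint.1 hint.neg.integrableOn ?_
          exact (ae_restrict_iff' measurableSet_Ioc).2 hstep
      _ = ∫ θ in Ioc 0 h, -∫ z : ℝ × ℝ, F (z.1, z.2 - θ) * g z := by
          rw [intervalIntegral.integral_neg, hJint, hfub, integral_neg]
      _ ≤ ∫ _ in Ioc 0 h, ε := by
          refine setIntegral_mono_on ?_ (integrableOn_const (by simp)) measurableSet_Ioc
            fun θ hθ => ?_
          · exact (integrable_translate_mul hqp hFL hgL h).integral_prod_left.neg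
          · have := hδ' (y := θ) (by
              rw [Real.dist_eq, sub_zero, abs_of_pos hθ.1]; exact hθ.2.trans_lt hhδ)
            linarith
      _ = ε * h := by
          rw [setIntegral_const, measureReal_def, Real.volume_Ioc, sub_zero,
            ENNReal.toReal_ofReal hh0.le, smul_eq_mul, mul_comm]
  have hG0 : G 0 = 0 := by
    have : ∫ x in Icc a b, excess p f u 0 x ^ 2 = 0 := by
      refine integral_eq_zero_of_ae ?_
      filter_upwards [hu0] with x hx
      simp only [excess, ← hm, Pi.zero_apply]
      rw [Real.zero_rpow (by linarith), max_eq_right (by linarith)]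
      simp
    simp only [hG, this, mul_zero]
  have hGt : G t ≤ 0 := by
    rcases ht.1.eq_or_lt with h | h
    · rw [← h, hG0]
    -- Backward steps needed a positive initial time; continuity of G extends the monotonicity down
    -- to time 0.
    · have hc : Tendsto G (𝓝[>] 0) (𝓝 (G 0)) :=
        (hGc 0 ⟨le_rfl, hT₁0⟩).mono_left (by
          rw [← nhdsWithin_Ioc_eq_nhdsGT (h.trans_le ht.2)]
          exact nhdsWithin_mono _ Ioc_subset_Icc_self)
      rw [← hG0]
      refine ge_of_tendsto hc ?_
      filter_upwards [Ioo_mem_nhdsGT h] with s hs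
      exact hmono s t hs.1 hs.2 ht.2
  have hmt : t ∈ Ioc (-τ) T := ⟨by linarith [ht.1], ht.2.trans hT₁⟩
  have hz : ∫ x in Icc a b, excess p f u t x ^ 2 = 0 := by
    have h1 : 0 ≤ ∫ x in Icc a b, excess p f u t x ^ 2 := integral_nonneg fun x => sq_nonneg _
    simp only [hG] at hGt
    linarith
  rw [integral_eq_zero_iff_of_nonneg (fun x => sq_nonneg _)
    (memLp_excess hS hEK hf.continuousOn hmt).integrable_sq] at hz
  filter_upwards [hz] with x hx
  have h1 : excess p f u t x = 0 := by simpa using hx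
  have h2 : t ^ m * f x - u x t ≤ excess p f u t x := le_max_left _ _
  linarith

/-! ### The explicit barrier. -/

/-- The amplitude of the barrier, depending only on `p`. -/
theorem exists_barrier_amplitude {p : ℝ} (hp₁ : 1 < p) (hp₂ : p < 2) :
    ∃ B : ℝ, 0 < B ∧ B ≤ 1 ∧
      1 / (2 - p) * B ≤ (B * (p / (2 - p))) ^ (p - 1) * (p / (2 - p) - 1) := by
  have h2 : 0 < 2 - p := by linarith
  set q := p / (2 - p) with hq
  have hq0 : 0 < q := by positivity
  -- As q - 1 = 2(p-1)/(2-p), the required inequality is equivalent to B^(2-p) ≤ C.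
  set C := 2 * (p - 1) * q ^ (p - 1) with hC
  have hC0 : 0 < C := by
    have : 0 < p - 1 := by linarith
    positivity
  set B := min 1 (C ^ (1 / (2 - p))) with hB
  have hB0 : 0 < B := lt_min one_pos (by positivity)
  refine ⟨B, hB0, min_le_left _ _, ?_⟩
  have hBC : B ^ (2 - p) ≤ C := by
    calc B ^ (2 - p) ≤ (C ^ (1 / (2 - p))) ^ (2 - p) :=
          Real.rpow_le_rpow hB0.le (min_le_right _ _) h2.le
      _ = C := by
          rw [← Real.rpow_mul hC0.le, one_div, inv_mul_cancel₀ h2.ne', Real.rpow_one]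
  have hsplit : B = B ^ (p - 1) * B ^ (2 - p) := by
    rw [← Real.rpow_add hB0, show p - 1 + (2 - p) = 1 by ring, Real.rpow_one]
  have hk : q - 1 = 2 * (p - 1) * (1 / (2 - p)) := by
    rw [hq]; field_simp; ring
  rw [Real.mul_rpow hB0.le hq0.le, hk]
  calc 1 / (2 - p) * B = 1 / (2 - p) * (B ^ (p - 1) * B ^ (2 - p)) := by rw [← hsplit]
    _ ≤ 1 / (2 - p) * (B ^ (p - 1) * C) := by gcongr
    _ = B ^ (p - 1) * q ^ (p - 1) * (2 * (p - 1) * (1 / (2 - p))) := by rw [hC]; ring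

/-- The barrier `B t^{1/(2-p)} ((e (x - y) + r)^{-p/(2-p)} - S)` is a sub-solution. -/
theorem isSubsolutionProfile_barrier {p : ℝ} (hp₁ : 1 < p) (hp₂ : p < 2) {B e r S a b y : ℝ}
    (hB : 0 < B)
    (hBp : 1 / (2 - p) * B ≤ (B * (p / (2 - p))) ^ (p - 1) * (p / (2 - p) - 1))
    (he : e = 1 ∨ e = -1) (hr : 0 < r) (hS : 0 ≤ S) (hK : ∀ x ∈ Icc a b, 0 ≤ e * (x - y)) :
    IsSubsolutionProfile p a b (fun x => B * ((e * (x - y) + r) ^ (-(p / (2 - p))) - S))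
      (fun x => B * (p / (2 - p)) * (e * (x - y) + r) ^ (-(p / (2 - p)) - 1) * -e)
      (fun x => (B * (p / (2 - p))) ^ (p - 1) * (p / (2 - p) - 1) *
        (e * (x - y) + r) ^ (-(p / (2 - p)))) := by
  have h2 : 0 < 2 - p := by linarith
  set q := p / (2 - p) with hq
  have hq0 : 0 < q := by positivity
  have hX : ∀ x ∈ Icc a b, 0 < e * (x - y) + r := fun x hx => by linarith [hK x hx]
  have hXd : ∀ x, HasDerivAt (fun x => e * (x - y) + r) e x := fun x => by
    simpa using (((hasDerivAt_id x).sub_const y).const_mul e).add_const r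
  have hpow : ∀ k x, x ∈ Icc a b →
      HasDerivAt (fun x => (e * (x - y) + r) ^ k) (e * k * (e * (x - y) + r) ^ (k - 1)) x :=
    fun k x hx => (hXd x).rpow_const (Or.inl (hX x hx).ne')
  have hpc : ∀ k : ℝ, ContinuousOn (fun x => (e * (x - y) + r) ^ k) (Icc a b) := fun k x hx =>
    (hpow k x hx).continuousAt.continuousWithinAt
  have hee : e * e = 1 := by rcases he with rfl | rfl <;> norm_num
  have hflux : pFlux p (-e) = -e := by
    have h1 : |-e| = 1 := by rcases he with rfl | rfl <;> norm_num
    rw [pFlux, h1, Real.one_rpow, one_mul]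
  -- This identity explains q: the flux of X^(-q) is a multiple of X^(-q+1), so its derivative is
  -- again a multiple of X^(-q).
  have hexp : (-q - 1) * (p - 1) = -q + 1 := by
    rw [hq]; field_simp; ring
  refine ⟨fun x hx => ?_, ?_, fun x hx => ?_, ?_, fun x hx => ?_⟩
  · exact (((hpow (-q) x hx).sub_const S).const_mul B).congr_deriv (by ring)
  · exact (continuousOn_const.mul (hpc _)).mul continuousOn_const
  · have h1 := ((hpow (-q + 1) x hx).const_mul ((B * q) ^ (p - 1))).mul_const (-e)
    have h3 : (B * q) ^ (p - 1) * (q - 1) * (e * (x - y) + r) ^ (-q) =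
        (B * q) ^ (p - 1) * (e * (-q + 1) * (e * (x - y) + r) ^ (-q + 1 - 1)) * -e := by
      rw [add_sub_cancel_right]
      linear_combination (-(B * q) ^ (p - 1) * (q - 1) * (e * (x - y) + r) ^ (-q)) * hee
    rw [h3]
    refine h1.congr_of_eventuallyEq ?_
    filter_upwards [(hXd x).continuousAt.eventually (lt_mem_nhds (hX x hx))] with z hz
    have hz' : 0 < e * (z - y) + r := hz
    have hzp : 0 < (e * (z - y) + r) ^ (-q - 1) := Real.rpow_pos_of_pos hz' _
    rw [pFlux_mul (by positivity), hflux, Real.mul_rpow (by positivity) hzp.le,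
      ← Real.rpow_mul hz'.le, hexp]
  · exact continuousOn_const.mul (hpc _)
  · have h1 : 0 ≤ (e * (x - y) + r) ^ (-q) := Real.rpow_nonneg (hX x hx).le _
    -- Subtracting S ≥ 0 lowers the left side and leaves the flux unchanged.
    calc 1 / (2 - p) * (B * ((e * (x - y) + r) ^ (-q) - S))
        ≤ 1 / (2 - p) * (B * (e * (x - y) + r) ^ (-q)) := by
          gcongr
          linarith
      _ = 1 / (2 - p) * B * (e * (x - y) + r) ^ (-q) := by ring
      _ ≤ _ := by gcongr

/-! ### Scaling and conclusion. -/

theorem rhoBar_pos {p T M : ℝ} (hT : 0 < T) (hM : 0 < M) : 0 < rhoBar p T M := by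
  unfold rhoBar
  positivity

/-- In this form the radius yields T^m r^(-q) = M/2, the bound for the barrier at y. -/
theorem rhoBar_rpow {p T M : ℝ} (hp₁ : 1 < p) (hp₂ : p < 2) (hT : 0 < T) (hM : 0 < M) :
    rhoBar p T M ^ (p / (2 - p)) = 2 * T ^ (1 / (2 - p)) / M := by
  have h2 : 0 < 2 - p := by linarith
  have hc : ∀ c : ℝ, 0 < c → (c ^ (2 - p)) ^ (1 / (2 - p)) = c := fun c hc => by
    rw [← Real.rpow_mul hc.le, mul_one_div_cancel h2.ne', Real.rpow_one]
  rw [rhoBar, ← Real.rpow_mul (by positivity), show 1 / p * (p / (2 - p)) = 1 / (2 - p) by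
    field_simp, Real.div_rpow (by positivity) (by positivity), hc M hM,
    Real.mul_rpow (by positivity) hT.le, hc 2 two_pos]

theorem proposition1p1 (p : ℝ) (hp₁ : 1 < p) (hp₂ : p < 2) :
    ∃ σ : ℝ, 0 < σ ∧ σ < 1 ∧
      ∀ (α β : EReal) (τ T : ℝ), 0 < τ → 0 < T →
      ∀ u : ℝ → ℝ → ℝ, IsLocalWeakSuperSolution p (openInterval α β) τ T u →
      (∀ t ∈ Ioc (-τ) T, ∀ᵐ x ∂(volume.restrict (openInterval α β)), 0 ≤ u x t) →
      ∀ y ∈ openInterval α β, ∀ M : ℝ, 0 < M →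
      (∀ t ∈ Ioc 0 (T / 2), (M : EReal) < pointValue u y t) →
      ∀ ρ : ℝ, 4 * rhoBar p T M ≤ ρ →
      ∀ xbar : ℝ, dist xbar y = 2 * ρ →
      Metric.ball xbar ρ ⊆ Metric.ball y (4 * ρ) →
      Metric.ball y (4 * ρ) ⊆ openInterval α β →
      ∀ x ∈ Metric.ball xbar ρ, ∀ t ∈ Icc (T / 4) (T / 2),
        ((σ * M * (rhoBar p T M / ρ) ^ (p / (2 - p)) : ℝ) : EReal) ≤ pointValue u x t := by
  obtain ⟨B, hB0, hB1, hBp⟩ := exists_barrier_amplitude hp₁ hp₂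
  have h2 : 0 < 2 - p := by linarith
  set m := 1 / (2 - p) with hm
  set q := p / (2 - p) with hq
  have hm0 : 0 < m := by positivity
  have hq0 : 0 < q := by positivity
  -- On the ball around `xbar` the distance to y is at most 3ρ and r ≤ ρ/4, which gives 13/4; the
  -- barrier vanishes at distance 7ρ/2, strictly beyond the ball and inside radius 4ρ.
  set κ : ℝ := (13 / 4 : ℝ) ^ (-q) - (7 / 2 : ℝ) ^ (-q) with hκ
  have hκ0 : 0 < κ :=
    sub_pos.2 (Real.rpow_lt_rpow_of_neg (by norm_num) (by norm_num) (by linarith))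
  have hκ1 : κ < 1 := by
    have h1 : (13 / 4 : ℝ) ^ (-q) < 1 :=
      Real.rpow_lt_one_of_one_lt_of_neg (by norm_num) (by linarith)
    have h3 : 0 < (7 / 2 : ℝ) ^ (-q) := by positivity
    linarith
  have hq1 : (1 / 4 : ℝ) ^ m ≤ 1 := Real.rpow_le_one (by norm_num) (by norm_num) hm0.le
  have hq2 : 0 < (1 / 4 : ℝ) ^ m := by positivity
  -- The factor (1/4)^m comes from t ≥ T/4, and 1/2 from T^m = M r^q / 2.
  refine ⟨(1 / 4 : ℝ) ^ m / 2 * B * κ, by positivity, ?_, ?_⟩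
  · have h1 : (1 / 4 : ℝ) ^ m / 2 * B ≤ 1 := mul_le_one₀ (by linarith) hB0.le hB1
    calc (1 / 4 : ℝ) ^ m / 2 * B * κ ≤ 1 * κ := by gcongr
      _ < 1 := by linarith
  intro α β τ T hτ hT u hu hpos y hy M hM hyM ρ hρ xbar hx hball hE x hxb t ht
  set E := openInterval α β
  set r := rhoBar p T M with hr
  have hr0 : 0 < r := rhoBar_pos hT hM
  have hρ0 : 0 < ρ := by linarith
  have hrq : r ^ q = 2 * T ^ m / M := rhoBar_rpow hp₁ hp₂ hT hM
  set R := 7 / 2 * ρ with hR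
  set S := (R + r) ^ (-q) with hS
  have hS0 : 0 ≤ S := by positivity
  obtain ⟨e, he, hxe⟩ : ∃ e : ℝ, (e = 1 ∨ e = -1) ∧ xbar = y + e * (2 * ρ) := by
    rw [Real.dist_eq] at hx
    rcases abs_eq (by linarith : 0 ≤ 2 * ρ) |>.1 hx with h | h
    · exact ⟨1, Or.inl rfl, by linarith⟩
    · exact ⟨-1, Or.inr rfl, by linarith⟩
  -- The comparison interval joins y to y + eR. The radius 15ρ/4, between 7ρ/2 and 4ρ, leaves a
  -- margin around both end points inside E.
  obtain ⟨a, b, hab, ha, hb, hKe, hend, hsub⟩ : ∃ a b : ℝ, a < b ∧ y - 15 / 4 * ρ < a ∧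
      b < y + 15 / 4 * ρ ∧ (∀ z ∈ Icc a b, 0 ≤ e * (z - y)) ∧
      (∀ z, z = a ∨ z = b → z = y ∨ e * (z - y) = R) ∧
      Ioo (xbar - ρ) (xbar + ρ) ⊆ Icc a b := by
    rcases he with rfl | rfl
    · refine ⟨y, y + R, by linarith, by linarith, by linarith, fun z hz => by linarith [hz.1],
        ?_, fun z hz => ⟨by linarith [hz.1], by linarith [hz.2]⟩⟩
      rintro z (rfl | rfl)
      · exact Or.inl rfl
      · right; ring
    · refine ⟨y - R, y, by linarith, by linarith, by linarith, fun z hz => by linarith [hz.2],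
        ?_, fun z hz => ⟨by linarith [hz.1], by linarith [hz.2]⟩⟩
      rintro z (rfl | rfl)
      · right; ring
      · exact Or.inl rfl
  have hEI : Icc (y - 15 / 4 * ρ) (y + 15 / 4 * ρ) ⊆ E := fun z hz => hE (by
    rw [Metric.mem_ball, Real.dist_eq, abs_lt]
    exact ⟨by linarith [hz.1], by linarith [hz.2]⟩)
  have hprof := isSubsolutionProfile_barrier (S := S) (y := y) hp₁ hp₂ hB0 hBp he hr0 hS0 hKe
  set f : ℝ → ℝ := fun x => B * ((e * (x - y) + r) ^ (-q) - S) with hf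
  have hint : ∀ s ∈ Ioc (-τ) T, ∀ K ⊆ E, IsCompact K → IntegrableOn (fun z => u z s) K := by
    intro s hs K hK hKc
    obtain ⟨ux, hS', -⟩ := hu
    have : IsFiniteMeasure (volume.restrict K) := ⟨by simpa using hKc.measure_lt_top⟩
    exact (hS'.memLp_slice K hK hKc s hs).integrable (by norm_num)
  have hbdry : ∀ z, z = a ∨ z = b → ∀ s ∈ Ioc 0 (T / 2),
      ((s ^ m * f z : ℝ) : EReal) ≤ pointValue u z s := by
    intro z hz s hs
    have hsT : s ∈ Ioc (-τ) T := ⟨by linarith [hs.1], by linarith [hs.2]⟩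
    rcases hend z hz with rfl | h
    · refine le_trans ?_ (hyM s hs).le
      rw [EReal.coe_le_coe_iff]
      have h1 : f z ≤ r ^ (-q) := by
        have h3 : 0 < r ^ (-q) := by positivity
        simp only [hf, sub_self, mul_zero, zero_add]
        calc B * (r ^ (-q) - S) ≤ B * r ^ (-q) := by gcongr; linarith
          _ ≤ 1 * r ^ (-q) := by gcongr
          _ = r ^ (-q) := one_mul _
      have h3 : s ^ m ≤ T ^ m := Real.rpow_le_rpow hs.1.le hsT.2 hm0.le
      have h4 : 0 < T ^ m := by positivity
      have h5 : 0 ≤ s ^ m := Real.rpow_nonneg hs.1.le _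
      calc s ^ m * f z ≤ s ^ m * r ^ (-q) := by gcongr
        _ ≤ T ^ m * r ^ (-q) := by gcongr
        _ = M / 2 := by
            rw [Real.rpow_neg hr0.le, hrq]
            field_simp
        _ ≤ M := by linarith
    -- At the far end point the barrier is zero, so nonnegativity of u suffices.
    · have hfz : f z = 0 := by simp [hf, h, hS]
      rw [hfz, mul_zero]
      have hzm : z ∈ Ioo (y - 15 / 4 * ρ) (y + 15 / 4 * ρ) := by
        rcases hz with rfl | rfl
        · exact ⟨ha, by linarith⟩
        · exact ⟨by linarith, hb⟩
      exact le_pointValue hzm ((hint s hsT _ hEI isCompact_Icc).mono_set Ioo_subset_Icc_self)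
        (ae_restrict_of_ae_restrict_of_subset (Ioo_subset_Icc_self.trans hEI) (hpos s hsT))
  have hKE : Icc a b ⊆ E := (Icc_subset_Icc ha.le hb.le).trans hEI
  have ht0 : 0 < t := by linarith [ht.1]
  have htT : t ∈ Ioc (-τ) T := ⟨by linarith, by linarith [ht.2]⟩
  have hcomp := ae_le_of_isSubsolutionProfile hp₁ hp₂ hτ hu ha hab hb hEI
    (by linarith : T / 2 ≤ T) hprof (hbdry a (Or.inl rfl)) (hbdry b (Or.inr rfl))
    (ae_restrict_of_ae_restrict_of_subset hKE (hpos 0 ⟨by linarith, hT.le⟩)) ⟨ht0.le, ht.2⟩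
  rw [Real.ball_eq_Ioo] at hxb
  refine le_pointValue hxb ((hint t htT _ hKE isCompact_Icc).mono_set hsub) ?_
  filter_upwards [ae_restrict_of_ae_restrict_of_subset hsub hcomp,
    ae_restrict_mem measurableSet_Ioo] with z hz hzm
  refine le_trans ?_ hz
  have hez : e * (z - y) ≤ 3 * ρ := by
    rcases he with rfl | rfl <;> linarith [hzm.1, hzm.2]
  have hez0 := hKe z (hsub hzm)
  have k1 : (13 / 4 : ℝ) ^ (-q) * ρ ^ (-q) ≤ (e * (z - y) + r) ^ (-q) := by
    rw [← Real.mul_rpow (by norm_num) hρ0.le]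
    exact Real.rpow_le_rpow_of_nonpos (by linarith) (by linarith) (by linarith)
  have k2 : S ≤ (7 / 2 : ℝ) ^ (-q) * ρ ^ (-q) := by
    rw [← Real.mul_rpow (by norm_num) hρ0.le]
    exact Real.rpow_le_rpow_of_nonpos (by positivity) (by linarith) (by linarith)
  have k3 : κ * ρ ^ (-q) ≤ (e * (z - y) + r) ^ (-q) - S := by
    rw [hκ, sub_mul]; linarith
  have k4 : (1 / 4 : ℝ) ^ m * T ^ m ≤ t ^ m := by
    rw [← Real.mul_rpow (by norm_num) hT.le]
    exact Real.rpow_le_rpow (by positivity) (by linarith [ht.1]) hm0.le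
  have hρq : 0 < ρ ^ (-q) := by positivity
  calc (1 / 4 : ℝ) ^ m / 2 * B * κ * M * (r / ρ) ^ q
      = (1 / 4 : ℝ) ^ m * T ^ m * (B * (κ * ρ ^ (-q))) := by
        rw [Real.div_rpow hr0.le hρ0.le, hrq, Real.rpow_neg hρ0.le]
        field_simp
    _ ≤ t ^ m * f z := by
        simp only [hf]
        gcongr
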